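/- Two finitely generated groups are called quasi-isometric if their Cayley graphs with respect to finite generating sets are quasi-isometric as metric spaces with the path metric (this does not depend on the finite generating sets chosen). (1) Let $A$ and $B$ be finitely generated groups, and let $F$ be a finite group with injective homomorphisms $F\to A$ and $F\to B$ by which $F$ is regarded as a common subgroup of $A$ and $B$. Suppose that $F$ is a proper subgroup of $A$ and of $B$. Unless $F$ has index $2$ in both $A$ and $B$, the amalgamated free product $A*_F B$ is quasi-isometric to the free product $A*B$. (2) Let $A$ be a finitely generated group, let $F_1,F_2\le A$ be finite proper subgroups and let $\varphi\colon F_1\to F_2$ be an isomorphism. Then the HNN extension $A*_F=\langle A,t \mid t f t^{-1}=\varphi(f),\ f\in F_1\rangle$ is quasi-isometric to the free product $A*\mathbb{Z}$. -/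

import Mathlib

/-- `f` is a quasi-isometry between the vertex sets of the graphs `X` and `Y`, each with its path
metric: distances are distorted by at most a multiplicative constant `K` and an additive constant
`C`, and every vertex of `Y` is within `C` of the image of `f`. This is used only for connected
graphs (for which `SimpleGraph.dist` is the path metric), which is part of the definition. -/
structure IsGraphQuasiIsometry {V : Type*} {W : Type*} (X : SimpleGraph V) (Y : SimpleGraph W)
    (f : V → W) : Prop where
  connected_left : X.Connected
  connected_right : Y.Connected
  exists_bounds : ∃ K C : ℝ, 1 ≤ K ∧ 0 ≤ C ∧
    (∀ x y : V, (1 / K) * (X.dist x y : ℝ) - C ≤ (Y.dist (f x) (f y) : ℝ) ∧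
      (Y.dist (f x) (f y) : ℝ) ≤ K * (X.dist x y : ℝ) + C) ∧
    (∀ w : W, ∃ x : V, (Y.dist (f x) w : ℝ) ≤ C)

/-- Two (finitely generated) groups are quasi-isometric if they have finite generating sets whose
Cayley graphs are quasi-isometric. Cayley graphs of the same group for different finite generating
sets are bilipschitz equivalent, so the choice of the generating sets is immaterial. -/
def GroupQuasiIsometric (G : Type*) (H : Type*) [Group G] [Group H] : Prop :=
  ∃ (S : Set G) (T : Set H), S.Finite ∧ T.Finite ∧
    Subgroup.closure S = ⊤ ∧ Subgroup.closure T = ⊤ ∧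
    ∃ f : G → H, IsGraphQuasiIsometry (SimpleGraph.mulCayley S) (SimpleGraph.mulCayley T) f

/-- The amalgamated free product `A *_F B` for homomorphisms `i : F → A` and `j : F → B`:
the quotient of the free product of `A` and `B` by the relations `i c = j c`, `c ∈ F`. -/
abbrev AmalgamatedProduct {A : Type*} {B : Type*} {F : Type*} [Group A] [Group B] [Group F]
    (i : F →* A) (j : F →* B) : Type _ :=
  Monoid.Coprod A B ⧸ Subgroup.normalClosure
    (Set.range fun c : F =>
      (Monoid.Coprod.inl (i c) * (Monoid.Coprod.inr (j c))⁻¹ : Monoid.Coprod A B))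

/-! By Bass–Serre theory both groups of each comparison are trees of cosets. After a choice of
transversals of the edge group, every element is uniquely a valid word times an element of `A`
(`hnnEval_bijective`, `amalgEval_bijective`), and the valid words are the vertices of a tree in
which only the backtracking letter is forbidden. A free product is the case of a trivial edge group,
with the whole group as transversal. Projection to a transversal maps its alphabet to the other one
by some `π` with bounded fibres, which have at least two elements if the edge group is nontrivial.

The heart is the bijection of words in `exists_validWord_equiv`. The children of a vertex are
grouped by target letters, essentially by `π`. The first member of the group of `s` goes to the
child `s` of the image vertex; the others are strung below it along letters `s₁`. While members of
its group remain, a vertex reserves `s₁` for the next one, and its own children are redirected away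
from `s₁`. Every other letter still receives a child, so the map is onto. Redirecting requires a
letter other than the forbidden and the reserved one, hence three letters in the target; for
amalgams this is where index `2` on both sides is excluded.

This bijection times the identity of `A` respects right multiplication by `A` and keeps neighbouring
cosets close in both directions (`rightBounded_hnn`, `rightBounded_amalg`). It is therefore a
bilipschitz bijection of word metrics. -/

/-! ### Word metrics and coarsely Lipschitz maps. -/

section WordMetric

variable {G H : Type*} [Group G] [Group H]

/-- Cayley graphs are homogeneous under left translation, so one bound for `d` serves at every `h`;
finite sets of displacements therefore give bounded distances. -/
theorem exists_cayley_walk_le {T : Set H} (hT : Subgroup.closure T = ⊤) (d : H) :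
    ∃ n : ℕ, ∀ h : H, ∃ w : (SimpleGraph.mulCayley T).Walk h (h * d), w.length ≤ n := by
  have hd : d ∈ Subgroup.closure T := by rw [hT]; trivial
  induction hd using Subgroup.closure_induction with
  | mem x hx =>
    refine ⟨1, fun h => ?_⟩
    by_cases hne : h = h * x
    · exact ⟨SimpleGraph.Walk.nil.copy rfl hne, by simp⟩
    · have : (SimpleGraph.mulCayley T).Adj h (h * x) := by
        rw [SimpleGraph.mulCayley_adj]; exact ⟨hne, Or.inl (by simpa using hx)⟩
      exact ⟨this.toWalk, by simp⟩
  | one => exact ⟨0, fun h => ⟨SimpleGraph.Walk.nil.copy rfl (by simp), by simp⟩⟩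
  | mul x y _ _ hx hy =>
    obtain ⟨n, hn⟩ := hx
    obtain ⟨m, hm⟩ := hy
    refine ⟨n + m, fun h => ?_⟩
    obtain ⟨w, hw⟩ := hn h
    obtain ⟨w', hw'⟩ := hm (h * x)
    exact ⟨(w.append w').copy rfl (mul_assoc _ _ _), by simp; omega⟩
  | inv x _ hx =>
    obtain ⟨n, hn⟩ := hx
    refine ⟨n, fun h => ?_⟩
    obtain ⟨w, hw⟩ := hn (h * x⁻¹)
    exact ⟨(w.copy rfl (by simp)).reverse, by simpa using hw⟩

theorem mulCayley_connected {T : Set H} (hT : Subgroup.closure T = ⊤) :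
    (SimpleGraph.mulCayley T).Connected := by
  refine { preconnected := fun x y => ?_, nonempty := ⟨1⟩ }
  obtain ⟨n, hn⟩ := exists_cayley_walk_le hT (x⁻¹ * y)
  obtain ⟨w, -⟩ := hn x
  exact ⟨w.copy rfl (by simp)⟩

/-- Right translations are moved by `f` to right translations by finitely many elements:
`f` is coarsely Lipschitz for word metrics. -/
def RightBounded (f : G → H) : Prop :=
  ∀ s : G, (Set.range fun g : G => (f g)⁻¹ * f (g * s)).Finite

/-- The displacement of a product `x * y` at `g` is the product of the displacements at `g` and at
`g * x`. -/
theorem RightBounded.of_closure {f : G → H} {S : Set G} (hS : Subgroup.closure S = ⊤)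
    (h : ∀ s ∈ S, (Set.range fun g : G => (f g)⁻¹ * f (g * s)).Finite) : RightBounded f := by
  intro s
  have hs : s ∈ Subgroup.closure S := by rw [hS]; trivial
  induction hs using Subgroup.closure_induction with
  | mem x hx => exact h x hx
  | one => exact (Set.finite_singleton 1).subset (by rintro _ ⟨g, rfl⟩; simp)
  | mul x y _ _ hx hy =>
    refine (hx.mul hy).subset ?_
    rintro _ ⟨g, rfl⟩
    exact ⟨_, ⟨g, rfl⟩, _, ⟨g * x, rfl⟩, by simp [mul_assoc]⟩
  | inv x _ hx =>
    refine hx.inv.subset ?_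
    rintro _ ⟨g, rfl⟩
    exact ⟨g * x⁻¹, by simp⟩

theorem MonoidHom.rightBounded (f : G →* H) : RightBounded f := fun s =>
  (Set.finite_singleton (f s)).subset (by rintro _ ⟨g, rfl⟩; simp)

theorem RightBounded.comp {K : Type*} [Group K] {k : H → K} {f : G → H}
    (hk : RightBounded k) (hf : RightBounded f) : RightBounded (k ∘ f) := by
  intro s
  refine ((hf s).biUnion fun d _ => hk d).subset ?_
  rintro _ ⟨g, rfl⟩
  refine Set.mem_biUnion ⟨g, rfl⟩ ⟨f g, ?_⟩
  simp

/-- Only finitely many displacements occur along the edges; their lengths add up along a geodesic.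
-/
theorem RightBounded.exists_dist_le {f : G → H} (hf : RightBounded f) {S : Set G} {T : Set H}
    (hSf : S.Finite) (hS : Subgroup.closure S = ⊤) (hT : Subgroup.closure T = ⊤) :
    ∃ K : ℕ, 1 ≤ K ∧ ∀ x y : G, (SimpleGraph.mulCayley T).dist (f x) (f y) ≤
      K * (SimpleGraph.mulCayley S).dist x y := by
  choose n hn using exists_cayley_walk_le hT
  have hfin : (⋃ s ∈ S, Set.range fun g : G => (f g)⁻¹ * f (g * s)).Finite :=
    hSf.biUnion fun s _ => hf s
  obtain ⟨K, hK⟩ := (hfin.image n).bddAbove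
  have key : ∀ x y, (SimpleGraph.mulCayley S).Adj x y →
      (SimpleGraph.mulCayley T).dist (f x) (f y) ≤ K := by
    have half : ∀ x y, x⁻¹ * y ∈ S → (SimpleGraph.mulCayley T).dist (f x) (f y) ≤ K := by
      intro x y hxy
      obtain ⟨w, hw⟩ := hn ((f x)⁻¹ * f y) (f x)
      have h1 := SimpleGraph.dist_le (w.copy rfl (by simp : f x * ((f x)⁻¹ * f y) = f y))
      have h2 : n ((f x)⁻¹ * f y) ≤ K := hK ⟨_, Set.mem_biUnion hxy ⟨x, by simp⟩, rfl⟩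
      simp only [SimpleGraph.Walk.length_copy] at h1
      omega
    intro x y hxy
    rw [SimpleGraph.mulCayley_adj] at hxy
    rcases hxy.2 with h | h
    · exact half x y h
    · rw [SimpleGraph.dist_comm]; exact half y x h
  -- The bound `K` may be `0`, and the constant must be at least `1`.
  refine ⟨K + 1, by omega, fun x y => ?_⟩
  obtain ⟨w, hw⟩ := (mulCayley_connected hS).exists_walk_length_eq_dist x y
  rw [← hw]
  clear hw
  induction w with
  | nil => simp
  | cons h p ih =>
    have := (mulCayley_connected hT).dist_triangle (u := f _) (v := f _) (w := f _) |>.trans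
      (add_le_add (key _ _ h) ih)
    refine this.trans ?_
    rw [SimpleGraph.Walk.length_cons]
    nlinarith

theorem groupQuasiIsometric_of_rightBounded [Group.FG G] [Group.FG H] (e : G ≃ H)
    (he : RightBounded e) (he' : RightBounded e.symm) : GroupQuasiIsometric G H := by
  obtain ⟨S, hS, hSf⟩ := Group.fg_iff.1 ‹Group.FG G›
  obtain ⟨T, hT, hTf⟩ := Group.fg_iff.1 ‹Group.FG H›
  obtain ⟨K, hK1, hK⟩ := he.exists_dist_le hSf hS hT
  obtain ⟨L, hL1, hL⟩ := he'.exists_dist_le hTf hT hS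
  refine ⟨S, T, hSf, hTf, hS, hT, e, mulCayley_connected hS, mulCayley_connected hT,
    max K L, 0, ?_, le_rfl, fun x y => ⟨?_, ?_⟩, fun w => ⟨e.symm w, by simp⟩⟩
  · exact le_max_of_le_left (by exact_mod_cast hK1)
  · have h1 := hL (e x) (e y)
    simp only [Equiv.symm_apply_apply] at h1
    have h1' : ((SimpleGraph.mulCayley S).dist x y : ℝ) ≤
        L * (SimpleGraph.mulCayley T).dist (e x) (e y) := by exact_mod_cast h1
    have hL0 : (0 : ℝ) < max (K : ℝ) L := lt_max_of_lt_right (by exact_mod_cast hL1)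
    rw [sub_zero, one_div, inv_mul_le_iff₀ hL0]
    refine h1'.trans ?_
    gcongr
    exact le_max_right _ _
  · have h1' : ((SimpleGraph.mulCayley T).dist (e x) (e y) : ℝ) ≤
        K * (SimpleGraph.mulCayley S).dist x y := by exact_mod_cast hK x y
    rw [add_zero]
    refine h1'.trans ?_
    gcongr
    exact le_max_left _ _

end WordMetric

/-! ### Matching two trees of words. -/

section Words

/-- Words `c :: l` (last letter first) in which no letter follows `c'` if it is `bk c'`. -/
def ValidWord {C : Type*} (bk : C → C) : List C → Prop
  | [] => True
  | c :: l => some c ≠ l.head?.map bk ∧ ValidWord bk l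

variable {C D : Type*}

/-- Letters of `C` other than `e : Option C` are grouped by letters `tgt` of `D` other than
`e' : Option D`, and each group is enumerated by `idx` and has `len` members. If the flag is set,
then the letter `s₁` is kept free. -/
structure LetterGrouping (C D : Type*) where
  s₁ : Option D → D
  tgt : Option D → Bool → C → D
  idx : Option C → Option D → Bool → C → ℕ
  len : Option C → Option D → Bool → D → ℕ
  s₁_ne : ∀ e, some (s₁ e) ≠ e
  tgt_ne : ∀ e b c, some (tgt e b c) ≠ e
  tgt_ne_s₁ : ∀ e c, tgt e true c ≠ s₁ e
  idx_inj : ∀ e e' b c c', some c ≠ e → some c' ≠ e → tgt e' b c = tgt e' b c' →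
    idx e e' b c = idx e e' b c' → c = c'
  idx_lt : ∀ e e' b c, some c ≠ e → idx e e' b c < len e e' b (tgt e' b c)
  exists_idx : ∀ e e' b s i, i < len e e' b s → ∃ c, some c ≠ e ∧ tgt e' b c = s ∧ idx e e' b c = i
  len_pos : ∀ e e' b s, some s ≠ e' → (b = true → s ≠ s₁ e') → 0 < len e e' b s

namespace LetterGrouping

variable (Γ : LetterGrouping C D) (bk : C → C) (bk' : D → D)

/-- Append the letter `s₁`. -/
def extend (q : List D) : List D := Γ.s₁ (q.head?.map bk') :: q

/-- The word over `D` that corresponds to a word over `C`, together with a flag that says whether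
the group of its last letter has further members. -/
def place : List C → List D × Bool
  | [] => ([], false)
  | c :: h =>
    ((Γ.extend bk')^[Γ.idx (h.head?.map bk) ((place h).1.head?.map bk') (place h).2 c]
        (Γ.tgt ((place h).1.head?.map bk') (place h).2 c :: (place h).1),
      decide (Γ.idx (h.head?.map bk) ((place h).1.head?.map bk') (place h).2 c + 1 <
        Γ.len (h.head?.map bk) ((place h).1.head?.map bk') (place h).2
          (Γ.tgt ((place h).1.head?.map bk') (place h).2 c)))

variable {bk'} in
theorem validWord_iterate_extend {q : List D} (hq : ValidWord bk' q) (n : ℕ) :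
    ValidWord bk' ((Γ.extend bk')^[n] q) := by
  induction n with
  | zero => exact hq
  | succ n ih =>
    rw [Function.iterate_succ_apply']
    exact ⟨Γ.s₁_ne _, ih⟩

theorem validWord_place (h : List C) : ValidWord bk' (Γ.place bk bk' h).1 := by
  induction h with
  | nil => trivial
  | cons c h ih =>
    refine Γ.validWord_iterate_extend (q := _ :: _) ?_ _
    exact ⟨Γ.tgt_ne _ _ _, ih⟩

theorem exists_iterate_extend (q : List D) (n : ℕ) :
    ∃ l : List D, l.length = n ∧ (∀ x ∈ l, x ∈ Set.range Γ.s₁) ∧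
      (Γ.extend bk')^[n] q = l ++ q := by
  induction n with
  | zero => exact ⟨[], rfl, by simp, rfl⟩
  | succ n ih =>
    obtain ⟨l, hl, hx, h⟩ := ih
    refine ⟨Γ.s₁ (((Γ.extend bk')^[n] q).head?.map bk') :: l, by simp [hl], ?_, ?_⟩
    · intro x hx'
      rcases List.mem_cons.1 hx' with rfl | hx'
      · exact ⟨_, rfl⟩
      · exact hx x hx'
    · rw [Function.iterate_succ_apply', extend, List.cons_append, ← h]

theorem extend_injective : Function.Injective (Γ.extend bk') :=
  fun _ _ h => (List.cons.inj h).2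

/-- Below the image of `h`, the only admissible letter not given to a child of `h` is a reserved
`s₁`, and it holds the next member of the group of `h`. This yields surjectivity and locates
preimages of neighbours. -/
theorem place_step {h : List C} (hh : ValidWord bk h) {s : D}
    (hs : some s ≠ (Γ.place bk bk' h).1.head?.map bk') :
    (∃ c e b, ValidWord bk (c :: h) ∧ Γ.tgt e b c = s ∧ e = (Γ.place bk bk' h).1.head?.map bk' ∧
      (Γ.place bk bk' (c :: h)).1 = s :: (Γ.place bk bk' h).1) ∨
    (∃ h₀ c₀ c e b, h = c₀ :: h₀ ∧ ValidWord bk (c :: h₀) ∧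
      e = (Γ.place bk bk' h₀).1.head?.map bk' ∧ Γ.tgt e b c₀ = Γ.tgt e b c ∧
      (Γ.place bk bk' (c :: h₀)).1 = s :: (Γ.place bk bk' h).1 ∧ s ∈ Set.range Γ.s₁) := by
  by_cases hf : (Γ.place bk bk' h).2 = true → s ≠ Γ.s₁ ((Γ.place bk bk' h).1.head?.map bk')
  · left
    obtain ⟨c, hc, ht, hi⟩ := Γ.exists_idx (h.head?.map bk) _ _ _ _ (Γ.len_pos _ _ _ _ hs hf)
    refine ⟨c, _, _, ⟨hc, hh⟩, ht, rfl, ?_⟩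
    rw [place, hi, ht, Function.iterate_zero_apply]
  · right
    push Not at hf
    obtain ⟨hb, hs₁⟩ := hf
    match h, hh, hb, hs₁ with
    -- The root has no siblings: its flag is `false`.
    | [], _, hb, _ => simp [place] at hb
    | c₀ :: h₀, hh, hb, hs₁ =>
      have hb' := hb
      rw [place, decide_eq_true_eq] at hb'
      obtain ⟨c, hc, ht, hi⟩ := Γ.exists_idx _ _ _ _ _ hb'
      refine ⟨h₀, c₀, c, _, (Γ.place bk bk' h₀).2, rfl, ⟨hc, hh.2⟩, rfl, ht.symm, ?_, _, hs₁.symm⟩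
      rw [place, hi, ht, Function.iterate_succ_apply', hs₁]
      rfl

theorem place_surjective {q : List D} (hq : ValidWord bk' q) :
    ∃ h, ValidWord bk h ∧ (Γ.place bk bk' h).1 = q := by
  induction q with
  | nil => exact ⟨[], trivial, rfl⟩
  | cons s q ih =>
    obtain ⟨h, hh, rfl⟩ := ih hq.2
    rcases Γ.place_step bk bk' hh hq.1 with ⟨c, _, _, hc, _, _, hp⟩ | ⟨h₀, _, c, _, _, _, hc, _, _, hp, _⟩
    · exact ⟨_, hc, hp⟩
    · exact ⟨_, hc, hp⟩

/-- Cancel the common applications of `extend`. If some remained on one side, `h` would itself be an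
earlier member `d :: h'` of the group of `c'`. Its letter `s₁` is then reserved, so its child `c`
cannot be placed there. -/
theorem eq_of_place_cons {h h' : List C} {c c' : C} (hc : ValidWord bk (c :: h))
    (hc' : ValidWord bk (c' :: h'))
    (ih : ∀ k : List C, ValidWord bk k →
      (Γ.place bk bk' h).1 = (Γ.place bk bk' k).1 → h = k)
    (heq : (Γ.place bk bk' (c :: h)).1 = (Γ.place bk bk' (c' :: h')).1)
    (hle : Γ.idx (h.head?.map bk) ((Γ.place bk bk' h).1.head?.map bk') (Γ.place bk bk' h).2 c ≤
      Γ.idx (h'.head?.map bk) ((Γ.place bk bk' h').1.head?.map bk') (Γ.place bk bk' h').2 c') :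
    c :: h = c' :: h' := by
  obtain ⟨k, hk⟩ := Nat.exists_eq_add_of_le hle
  have heq' := heq
  simp only [place] at heq'
  rw [hk, Function.iterate_add_apply] at heq'
  replace heq' := (Γ.extend_injective bk').iterate _ heq'
  cases k with
  | zero =>
    rw [Function.iterate_zero_apply] at heq'
    obtain ⟨h1, h2⟩ := List.cons.inj heq'
    obtain rfl := ih _ hc'.2 h2
    rw [Γ.idx_inj _ _ _ _ _ hc.1 hc'.1 h1 hk.symm]
  | succ k =>
    exfalso
    rw [Function.iterate_succ_apply'] at heq'
    obtain ⟨h1, h2⟩ := List.cons.inj heq'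
    have hlt := Γ.idx_lt _ ((Γ.place bk bk' h').1.head?.map bk') (Γ.place bk bk' h').2 _ hc'.1
    rw [hk] at hlt
    -- Index `k` occurs before that of `c'`, so `d` is not last in the group and its flag is set.
    obtain ⟨d, hd, ht, hi⟩ := Γ.exists_idx _ _ _ _ k (lt_of_le_of_lt (by omega) hlt)
    have hp : (Γ.place bk bk' h).1 = (Γ.place bk bk' (d :: h')).1 := by
      rw [h2, place, hi, ht]
    have hhd := ih (d :: h') ⟨hd, hc'.2⟩ hp
    have hb : (Γ.place bk bk' h).2 = true := by
      rw [hhd, place, hi, ht, decide_eq_true_eq]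
      omega
    rw [← h2] at h1
    rw [hb] at h1
    exact Γ.tgt_ne_s₁ _ _ h1

theorem length_place_lt (h : List C) (c : C) :
    (Γ.place bk bk' h).1.length < (Γ.place bk bk' (c :: h)).1.length := by
  rw [place]
  obtain ⟨l, -, -, hl⟩ := Γ.exists_iterate_extend bk'
    (Γ.tgt ((Γ.place bk bk' h).1.head?.map bk') (Γ.place bk bk' h).2 c :: (Γ.place bk bk' h).1)
    (Γ.idx (h.head?.map bk) ((Γ.place bk bk' h).1.head?.map bk') (Γ.place bk bk' h).2 c)
  rw [hl]
  simp only [List.length_append, List.length_cons]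
  omega

/-- The image length is common to both words and drops for both parents, so the induction allows the
two words to be exchanged. -/
theorem place_injective : ∀ (n : ℕ) {h h' : List C}, ValidWord bk h → ValidWord bk h' →
    (Γ.place bk bk' h).1.length < n → (Γ.place bk bk' h).1 = (Γ.place bk bk' h').1 → h = h' := by
  intro n
  induction n with
  | zero => intro h h' _ _ hn; omega
  | succ n ih =>
    intro h h' hh hh' hn heq
    match h, h', hh, hh', hn, heq with
    | [], [], _, _, _, _ => rfl
    | [], c' :: h', _, _, _, heq =>
      have := Γ.length_place_lt bk bk' h' c'
      rw [← heq] at this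
      simp [place] at this
    | c :: h, [], _, _, _, heq =>
      have := Γ.length_place_lt bk bk' h c
      rw [heq] at this
      simp [place] at this
    | c :: h, c' :: h', hh, hh', hn, heq =>
      have l1 := Γ.length_place_lt bk bk' h c
      have l2 := Γ.length_place_lt bk bk' h' c'
      rw [← heq] at l2
      rcases le_total
        (Γ.idx (h.head?.map bk) ((Γ.place bk bk' h).1.head?.map bk') (Γ.place bk bk' h).2 c)
        (Γ.idx (h'.head?.map bk) ((Γ.place bk bk' h').1.head?.map bk')
          (Γ.place bk bk' h').2 c') with hle | hle
      · exact Γ.eq_of_place_cons bk bk' hh hh'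
          (fun k hk he => ih hh.2 hk (by omega) he) heq hle
      · exact (Γ.eq_of_place_cons bk bk' hh' hh
          (fun k hk he => ih hh'.2 hk (by omega) he) heq.symm hle).symm

/-- `place` as a bijection of the valid words. -/
noncomputable def placeEquiv : {l : List C // ValidWord bk l} ≃ {l : List D // ValidWord bk' l} :=
  Equiv.ofBijective (fun h => ⟨(Γ.place bk bk' h.1).1, Γ.validWord_place bk bk' h.1⟩)
    ⟨fun h h' heq => Subtype.ext (Γ.place_injective bk bk' _ h.2 h'.2 (Nat.lt_succ_self _)
      (congrArg Subtype.val heq)), fun q => by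
        obtain ⟨h, hh, hq⟩ := Γ.place_surjective bk bk' q.2
        exact ⟨⟨h, hh⟩, Subtype.ext hq⟩⟩

theorem placeEquiv_symm_eq {h : List C} (hh : ValidWord bk h) {q : List D} (hq : ValidWord bk' q)
    (he : (Γ.place bk bk' h).1 = q) : (Γ.placeEquiv bk bk').symm ⟨q, hq⟩ = ⟨h, hh⟩ := by
  rw [Equiv.symm_apply_eq]
  exact Subtype.ext he.symm

end LetterGrouping

theorem exists_enumeration (X : Set C) (τ : C → D) (hτ : ∀ s, (τ ⁻¹' {s}).Finite) :
    ∃ idx : C → ℕ, (∀ c ∈ X, ∀ c' ∈ X, τ c = τ c' → idx c = idx c' → c = c') ∧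
      (∀ c ∈ X, idx c < (X ∩ τ ⁻¹' {τ c}).ncard) ∧
      ∀ s i, i < (X ∩ τ ⁻¹' {s}).ncard → ∃ c ∈ X, τ c = s ∧ idx c = i := by
  classical
  have hfin : ∀ s, Finite (X ∩ τ ⁻¹' {s} : Set C) := fun s => (hτ s).subset Set.inter_subset_right
  let ε : ∀ s, (X ∩ τ ⁻¹' {s} : Set C) ≃ Fin (X ∩ τ ⁻¹' {s} : Set C).ncard :=
    fun s => Finite.equivFinOfCardEq rfl
  let idx : C → ℕ := fun c => if hc : c ∈ X then ε (τ c) ⟨c, hc, rfl⟩ else 0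
  have hidx : ∀ s (c : (X ∩ τ ⁻¹' {s} : Set C)), idx c = ε s c := by
    rintro s ⟨c, hc, rfl⟩
    simp only [idx, dif_pos hc]
  refine ⟨idx, ?_, ?_, ?_⟩
  · intro c hc c' hc' h1 h2
    have e1 := hidx (τ c) ⟨c, hc, rfl⟩
    have e2 := hidx (τ c) ⟨c', hc', h1.symm⟩
    simp only at e1 e2
    rw [e1, e2] at h2
    exact congrArg Subtype.val ((ε _).injective (Fin.ext h2))
  · intro c hc
    have e1 := hidx (τ c) ⟨c, hc, rfl⟩
    simp only at e1
    rw [e1]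
    exact Fin.is_lt _
  · intro s i hi
    refine ⟨(ε s).symm ⟨i, hi⟩, ((ε s).symm ⟨i, hi⟩).2.1, ((ε s).symm ⟨i, hi⟩).2.2, ?_⟩
    rw [hidx, Equiv.apply_symm_apply]

/-- Group by `π`, but redirect to a spare letter `s₂` the targets that are forbidden or reserved.
Three letters suffice to choose `s₁` and `s₂` distinct and different from `e`. For `e` in `R`,
redirection takes place inside the finite set `E`. -/
theorem exists_letterGrouping (π : C → D) {N : ℕ} (hfin : ∀ d, (π ⁻¹' {d}).Finite)
    (hN : ∀ d, (π ⁻¹' {d}).ncard ≤ N) (htwo : ∀ d, ∃ c c', c ≠ c' ∧ π c = d ∧ π c' = d)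
    {x y z : D} (hxy : x ≠ y) (hxz : x ≠ z) (hyz : y ≠ z) (R : Set D) (hR : R.Finite) :
    ∃ (Γ : LetterGrouping C D) (E : Set D) (M : ℕ), E.Finite ∧ R ⊆ E ∧ Set.range Γ.s₁ ⊆ E ∧
      (∀ e e' b s, (∀ r, e' = some r → r ∈ R) → Γ.len e e' b s ≤ M) ∧
      ∀ e b c, (∀ r, e = some r → r ∈ R) →
        Γ.tgt e b c = π c ∨ (Γ.tgt e b c ∈ E ∧ π c ∈ E) := by
  classical
  have hs : ∀ e : Option D, ∃ s₁ s₂ : D, s₁ ≠ s₂ ∧ some s₁ ≠ e ∧ some s₂ ≠ e ∧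
      s₁ ∈ ({x, y, z} : Set D) ∧ s₂ ∈ ({x, y, z} : Set D) := by
    intro e
    by_cases h1 : some x = e
    · exact ⟨y, z, hyz, by simp [← h1, hxy.symm], by simp [← h1, hxz.symm], by simp, by simp⟩
    · by_cases h2 : some y = e
      · exact ⟨x, z, hxz, h1, by simp [← h2, hyz.symm], by simp, by simp⟩
      · exact ⟨x, y, hxy, h1, h2, by simp, by simp⟩
  choose s₁ s₂ h12 hs₁ hs₂ hm₁ hm₂ using hs
  let r : Option D → Bool → D → D := fun e b t =>
    if some t = e ∨ (b = true ∧ t = s₁ e) then s₂ e else t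
  have hr : ∀ e b t, r e b t = t ∨
      (r e b t ∈ ({x, y, z} : Set D) ∧ (some t = e ∨ t ∈ ({x, y, z} : Set D))) := by
    intro e b t
    by_cases h : some t = e ∨ (b = true ∧ t = s₁ e)
    · refine Or.inr ⟨by simpa only [r, if_pos h] using hm₂ e, h.imp_right ?_⟩
      rintro ⟨-, rfl⟩
      exact hm₁ e
    · exact Or.inl (by simp only [r, if_neg h])
  have hsub : ∀ e b s, (fun c => r e b (π c)) ⁻¹' {s} ⊆
      π ⁻¹' {s} ∪ (⋃ d ∈ ({d | some d = e} ∪ {x, y, z} : Set D), π ⁻¹' {d}) := by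
    intro e b s c hc
    rcases hr e b (π c) with h | h
    · left
      simpa [h] using hc
    · exact Or.inr (Set.mem_biUnion (show π c ∈ _ from h.2) rfl)
  have hef : ∀ e : Option D, ({d | some d = e} ∪ {x, y, z} : Set D).Finite := by
    intro e
    refine Set.Finite.union ?_ (by simp)
    refine Set.Subsingleton.finite fun a ha b hb => Option.some_inj.1 (ha.trans hb.symm)
  have hτ : ∀ e b s, ((fun c => r e b (π c)) ⁻¹' {s}).Finite := fun e b s =>
    ((hfin s).union ((hef e).biUnion fun d _ => hfin d)).subset (hsub e b s)
  choose idx h1 h2 h3 using fun (e : Option C) (e' : Option D) (b : Bool) =>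
    exists_enumeration {c | some c ≠ e} (fun c => r e' b (π c)) (hτ e' b)
  have hEf : (R ∪ {x, y, z} : Set D).Finite := hR.union (by simp)
  refine ⟨⟨s₁, fun e b c => r e b (π c), idx,
      fun e e' b s => ({c | some c ≠ e} ∩ (fun c => r e' b (π c)) ⁻¹' {s}).ncard, hs₁, ?_, ?_,
      fun e e' b c c' hc hc' => h1 e e' b c hc c' hc', h2, h3, ?_⟩,
    R ∪ {x, y, z}, N + (⋃ d ∈ (R ∪ {x, y, z} : Set D), π ⁻¹' {d}).ncard, hEf,
    Set.subset_union_left, ?_, ?_, ?_⟩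
  · intro e b c
    by_cases h : some (π c) = e ∨ (b = true ∧ π c = s₁ e)
    · simpa only [r, if_pos h] using hs₂ e
    · simp only [r, if_neg h]
      exact fun h' => h (Or.inl h')
  · intro e c
    by_cases h : some (π c) = e ∨ (true = true ∧ π c = s₁ e)
    · simpa only [r, if_pos h] using (h12 e).symm
    · simp only [r, if_neg h]
      exact fun h' => h (Or.inr ⟨rfl, h'⟩)
  · intro e e' b s hse hb
    have hs : r e' b s = s := by
      simp only [r]
      refine if_neg ?_
      rintro (h | ⟨h, h'⟩)
      · exact hse h
      · exact hb h h'
    rw [Set.ncard_pos ((hτ e' b s).subset Set.inter_subset_right)]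
    obtain ⟨c, c', hcc, hc, hc'⟩ := htwo s
    -- At most one of the two preimages is the forbidden letter.
    by_cases he : some c = e
    · exact ⟨c', fun h => hcc (Option.some_inj.1 (he.trans h.symm)), by simp [hc', hs]⟩
    · exact ⟨c, he, by simp [hc, hs]⟩
  · rintro _ ⟨e, rfl⟩
    exact Or.inr (hm₁ e)
  · intro e e' b s hR'
    -- Besides its own fibre, a group can absorb only redirected fibres, all of them over `E`.
    have hsub' : ({c | some c ≠ e} ∩ (fun c => r e' b (π c)) ⁻¹' {s}) ⊆
        π ⁻¹' {s} ∪ ⋃ d ∈ (R ∪ {x, y, z} : Set D), π ⁻¹' {d} := by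
      refine Set.inter_subset_right.trans ((hsub e' b s).trans ?_)
      refine Set.union_subset_union_right _ (Set.biUnion_subset_biUnion_left ?_)
      exact Set.union_subset_union_left _ fun d hd => hR' d hd.symm
    refine (Set.ncard_le_ncard hsub' ((hfin s).union (hEf.biUnion fun d _ => hfin d))).trans ?_
    refine (Set.ncard_union_le _ _).trans ?_
    gcongr
    exact hN s
  · intro e b c hR'
    refine (hr e b (π c)).imp_right fun h => ⟨Or.inr h.1, ?_⟩
    exact h.2.imp (fun h => hR' _ h.symm) id

/-- Two systems of words, related by a map `π` of the letters that is at least two-to-one and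
boundedly finite-to-one, correspond to each other by a bijection that moves the successors of
a word a bounded distance. -/
theorem exists_validWord_equiv (bk : C → C) (bk' : D → D) (hbk' : (Set.range bk').Finite)
    (π : C → D) {N : ℕ} (hfin : ∀ d, (π ⁻¹' {d}).Finite)
    (hN : ∀ d, (π ⁻¹' {d}).ncard ≤ N) (htwo : ∀ d, ∃ c c', c ≠ c' ∧ π c = d ∧ π c' = d)
    {x y z : D} (hxy : x ≠ y) (hxz : x ≠ z) (hyz : y ≠ z) :
    ∃ (φ : {l : List C // ValidWord bk l} ≃ {l : List D // ValidWord bk' l}) (E : Set D) (M : ℕ),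
      E.Finite ∧
      (∀ p c (hc : ValidWord bk (c :: p)), ∃ l s, l.length ≤ M ∧ (∀ x ∈ l, x ∈ E) ∧
        (φ ⟨c :: p, hc⟩).1 = l ++ s :: (φ ⟨p, hc.2⟩).1 ∧ (s = π c ∨ (s ∈ E ∧ π c ∈ E))) ∧
      (∀ q s (hs : ValidWord bk' (s :: q)),
        (∃ c, (φ.symm ⟨s :: q, hs⟩).1 = c :: (φ.symm ⟨q, hs.2⟩).1 ∧
          (s = π c ∨ (s ∈ E ∧ π c ∈ E))) ∨
        (∃ h c c', (φ.symm ⟨q, hs.2⟩).1 = c :: h ∧ (φ.symm ⟨s :: q, hs⟩).1 = c' :: h ∧ s ∈ E ∧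
          (π c = π c' ∨ (π c ∈ E ∧ π c' ∈ E)))) := by
  obtain ⟨Γ, E, M, hE, hRE, hsE, hlen, htgt⟩ :=
    exists_letterGrouping π hfin hN htwo hxy hxz hyz (Set.range bk') hbk'
  have hmap : ∀ (q : List D) (r : D), q.head?.map bk' = some r → r ∈ Set.range bk' := by
    intro q r h
    obtain ⟨a, -, rfl⟩ := Option.map_eq_some_iff.1 h
    exact ⟨a, rfl⟩
  refine ⟨Γ.placeEquiv bk bk', E, M, hE, ?_, ?_⟩
  · intro p c hc
    obtain ⟨l, hl, hlE, he⟩ := Γ.exists_iterate_extend bk'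
      (Γ.tgt ((Γ.place bk bk' p).1.head?.map bk') (Γ.place bk bk' p).2 c :: (Γ.place bk bk' p).1)
      (Γ.idx (p.head?.map bk) ((Γ.place bk bk' p).1.head?.map bk') (Γ.place bk bk' p).2 c)
    refine ⟨l, _, ?_, fun x hx => hsE (hlE x hx), he, htgt _ _ _ (hmap _)⟩
    rw [hl]
    exact (Γ.idx_lt _ _ _ _ hc.1).le.trans (hlen _ _ _ _ (hmap _))
  · intro q s hs
    obtain ⟨h, hh, rfl⟩ := Γ.place_surjective bk bk' hs.2
    rw [Γ.placeEquiv_symm_eq bk bk' hh hs.2 rfl]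
    rcases Γ.place_step bk bk' hh hs.1 with
      ⟨c, e, b, hc, ht, rfl, hp⟩ | ⟨h₀, c₀, c, e, b, rfl, hc, rfl, ht, hp, hsr⟩
    · left
      refine ⟨c, ?_, ?_⟩
      · rw [Γ.placeEquiv_symm_eq bk bk' hc hs hp]
      · rw [← ht]
        exact htgt _ _ _ (hmap _)
    · right
      refine ⟨h₀, c₀, c, rfl, ?_, hsE hsr, ?_⟩
      · rw [Γ.placeEquiv_symm_eq bk bk' hc hs hp]
      · have t1 := htgt ((Γ.place bk bk' h₀).1.head?.map bk') b c₀ (hmap _)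
        have t2 := htgt ((Γ.place bk bk' h₀).1.head?.map bk') b c (hmap _)
        rw [ht] at t1
        rcases t1 with t1 | t1 <;> rcases t2 with t2 | t2
        · exact Or.inl (t1.symm.trans t2)
        · exact Or.inr ⟨t1 ▸ t2.1, t2.2⟩
        · exact Or.inr ⟨t1.2, t2 ▸ t1.1⟩
        · exact Or.inr ⟨t1.2, t2.2⟩

end Words

/-! ### The tree of words and its edges. -/

section Switch

variable {U W : Type*}

/-- The letter that undoes a given letter: `u₀` undoes the letters in `W`, and `w₀` those in `U`. -/
def backLetter (u₀ : U) (w₀ : W) : U ⊕ W → U ⊕ W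
  | .inl _ => .inr w₀
  | .inr _ => .inl u₀

theorem finite_range_backLetter (u₀ : U) (w₀ : W) : (Set.range (backLetter u₀ w₀)).Finite :=
  (Set.toFinite {Sum.inr w₀, Sum.inl u₀}).subset (by
    rintro _ ⟨_ | _, rfl⟩ <;> simp [backLetter])

open Classical in
/-- Cross the edge with label `u` at the vertex `l`. -/
noncomputable def crossLeft (u₀ : U) (w₀ : W) : List (U ⊕ W) → U → List (U ⊕ W) × W
  | .inr v :: l, u => if u = u₀ then (l, v) else (.inl u :: .inr v :: l, w₀)
  | .inl v :: l, u => (.inl u :: .inl v :: l, w₀)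
  | [], u => ([.inl u], w₀)

open Classical in
/-- Cross the edge with label `w` at the vertex `l`. -/
noncomputable def crossRight (u₀ : U) (w₀ : W) : List (U ⊕ W) → W → List (U ⊕ W) × U
  | .inl v :: l, w => if w = w₀ then (l, v) else (.inr w :: .inl v :: l, u₀)
  | .inr v :: l, w => (.inr w :: .inr v :: l, u₀)
  | [], w => ([.inr w], u₀)

variable (u₀ : U) (w₀ : W)

/-- An edge leads away from the root unless its label undoes the last letter. -/
theorem crossLeft_cases {l : List (U ⊕ W)} (hl : ValidWord (backLetter u₀ w₀) l) (u : U) :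
    (ValidWord (backLetter u₀ w₀) (.inl u :: l) ∧ crossLeft u₀ w₀ l u = (.inl u :: l, w₀)) ∨
      ∃ v l', l = .inr v :: l' ∧ u = u₀ ∧ crossLeft u₀ w₀ l u = (l', v) := by
  match l, hl with
  | [], hl => exact Or.inl ⟨⟨by simp, hl⟩, rfl⟩
  | .inl v :: l, hl => exact Or.inl ⟨⟨by simp [backLetter], hl⟩, rfl⟩
  | .inr v :: l, hl =>
    by_cases h : u = u₀
    · exact Or.inr ⟨v, l, rfl, h, by simp [crossLeft, h]⟩
    · exact Or.inl ⟨⟨by simp [backLetter, h], hl⟩, by simp [crossLeft, h]⟩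

theorem validWord_crossLeft {l : List (U ⊕ W)} (hl : ValidWord (backLetter u₀ w₀) l) (u : U) :
    ValidWord (backLetter u₀ w₀) (crossLeft u₀ w₀ l u).1 := by
  rcases crossLeft_cases u₀ w₀ hl u with ⟨h, he⟩ | ⟨v, l', rfl, -, he⟩
  · rw [he]; exact h
  · rw [he]; exact hl.2

theorem validWord_crossRight {l : List (U ⊕ W)} (hl : ValidWord (backLetter u₀ w₀) l) (w : W) :
    ValidWord (backLetter u₀ w₀) (crossRight u₀ w₀ l w).1 := by
  match l, hl with
  | [], hl => exact ⟨by simp, hl⟩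
  | .inr v :: l, hl => exact ⟨by simp [backLetter], hl⟩
  | .inl v :: l, hl =>
    by_cases h : w = w₀
    · simpa [crossRight, h] using hl.2
    · simp only [crossRight, if_neg h]
      exact ⟨by simp [backLetter, h], hl⟩

theorem crossRight_crossLeft {l : List (U ⊕ W)} (hl : ValidWord (backLetter u₀ w₀) l) (u : U) :
    crossRight u₀ w₀ (crossLeft u₀ w₀ l u).1 (crossLeft u₀ w₀ l u).2 = (l, u) := by
  rcases crossLeft_cases u₀ w₀ hl u with ⟨-, he⟩ | ⟨v, l', rfl, rfl, he⟩
  · simp [he, crossRight]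
  · rw [he]
    match l', hl with
    | [], _ => rfl
    | .inr _ :: _, _ => rfl
    | .inl _ :: _, hl =>
      have : v ≠ w₀ := by simpa [backLetter] using hl.1
      simp [crossRight, this]

theorem crossLeft_crossRight {l : List (U ⊕ W)} (hl : ValidWord (backLetter u₀ w₀) l) (w : W) :
    crossLeft u₀ w₀ (crossRight u₀ w₀ l w).1 (crossRight u₀ w₀ l w).2 = (l, w) := by
  match l, hl with
  | [], _ => simp [crossRight, crossLeft]
  | .inr v :: l, _ => simp [crossRight, crossLeft]
  | .inl v :: l, hl =>
    by_cases h : w = w₀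
    · simp only [crossRight, if_pos h]
      match l, hl with
      | [], _ => simp [crossLeft, h]
      | .inl _ :: _, _ => simp [crossLeft, h]
      | .inr _ :: _, hl =>
        have : v ≠ u₀ := by simpa [backLetter] using hl.1
        simp [crossLeft, this, h]
    · simp [crossRight, crossLeft, h]

/-- The valid words in `U ⊕ W` are the vertices of a tree with `U ⊕ W` as the set of
labels of the half-edges at each vertex. This is the other end of a half-edge. -/
noncomputable def crossEquiv : {l // ValidWord (backLetter u₀ w₀) l} × U ≃
    {l // ValidWord (backLetter u₀ w₀) l} × W where
  toFun x := (⟨(crossLeft u₀ w₀ x.1.1 x.2).1, validWord_crossLeft u₀ w₀ x.1.2 x.2⟩,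
    (crossLeft u₀ w₀ x.1.1 x.2).2)
  invFun x := (⟨(crossRight u₀ w₀ x.1.1 x.2).1, validWord_crossRight u₀ w₀ x.1.2 x.2⟩,
    (crossRight u₀ w₀ x.1.1 x.2).2)
  left_inv x := by
    have h := crossRight_crossLeft u₀ w₀ x.1.2 x.2
    exact Prod.ext (Subtype.ext (Prod.ext_iff.1 h).1) (Prod.ext_iff.1 h).2
  right_inv x := by
    have h := crossLeft_crossRight u₀ w₀ x.1.2 x.2
    exact Prod.ext (Subtype.ext (Prod.ext_iff.1 h).1) (Prod.ext_iff.1 h).2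

theorem crossEquiv_cases (p : {l // ValidWord (backLetter u₀ w₀) l}) (u : U) :
    (∃ h : ValidWord (backLetter u₀ w₀) (.inl u :: p.1),
      crossEquiv u₀ w₀ (p, u) = (⟨.inl u :: p.1, h⟩, w₀)) ∨
    ∃ v p', ∃ h : ValidWord (backLetter u₀ w₀) (.inr v :: p'), p = ⟨.inr v :: p', h⟩ ∧ u = u₀ ∧
      crossEquiv u₀ w₀ (p, u) = (⟨p', h.2⟩, v) := by
  obtain ⟨l, hl⟩ := p
  rcases crossLeft_cases u₀ w₀ hl u with ⟨h, he⟩ | ⟨v, l', rfl, hu, he⟩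
  · exact Or.inl ⟨h, Prod.ext (Subtype.ext (Prod.ext_iff.1 he).1) (Prod.ext_iff.1 he).2⟩
  · exact Or.inr ⟨v, l', hl, rfl, hu,
      Prod.ext (Subtype.ext (Prod.ext_iff.1 he).1) (Prod.ext_iff.1 he).2⟩

theorem crossEquiv_symm_of_validWord (p : {l // ValidWord (backLetter u₀ w₀) l}) (w : W)
    (h : ValidWord (backLetter u₀ w₀) (.inr w :: p.1)) :
    (crossEquiv u₀ w₀).symm (p, w) = (⟨.inr w :: p.1, h⟩, u₀) := by
  rw [Equiv.symm_apply_eq]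
  refine Prod.ext (Subtype.ext ?_) ?_ <;> simp [crossEquiv, crossLeft]

theorem crossEquiv_of_validWord (p : {l // ValidWord (backLetter u₀ w₀) l}) (u : U)
    (h : ValidWord (backLetter u₀ w₀) (.inl u :: p.1)) :
    crossEquiv u₀ w₀ (p, u) = (⟨.inl u :: p.1, h⟩, w₀) := by
  rw [← Equiv.eq_symm_apply]
  refine Prod.ext (Subtype.ext ?_) ?_ <;> simp [crossEquiv, crossRight]

end Switch

/-! ### Equivariant bijections from transversals. -/

section Transversals

variable {A B : Type*} [Group A] [Group B] {H : Subgroup A} {K : Subgroup B} {S : Set A} {T : Set B}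

open Subgroup in
theorem isComplement_equiv_mul (hS : IsComplement S (H : Set A)) (s : S) (h : H) :
    hS.equiv (s * h) = (s, h) := by
  rw [← Equiv.eq_symm_apply]
  rfl

/-- Extend a bijection between sets of cosets to an equivariant bijection, where the cosets
are trivialized by transversals. -/
noncomputable def torsorEquiv {P Q : Type*} (hS : Subgroup.IsComplement S (H : Set A))
    (hT : Subgroup.IsComplement T (K : Set B)) (ψ : H ≃* K) (Θ : P × S ≃ Q × T) : P × A ≃ Q × B :=
  ((Equiv.refl P).prodCongr hS.equiv).trans <| (Equiv.prodAssoc P S H).symm.trans <|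
    (Θ.prodCongr ψ.toEquiv).trans <| (Equiv.prodAssoc Q T K).trans <|
      (Equiv.refl Q).prodCongr hT.equiv.symm

variable {P Q : Type*} (hS : Subgroup.IsComplement S (H : Set A))
    (hT : Subgroup.IsComplement T (K : Set B)) (ψ : H ≃* K) (Θ : P × S ≃ Q × T)

theorem torsorEquiv_apply_mul (p : P) (s : S) (h : H) :
    torsorEquiv hS hT ψ Θ (p, s * h) = ((Θ (p, s)).1, ((Θ (p, s)).2 : B) * (ψ h : B)) := by
  simp only [torsorEquiv, Equiv.trans_apply, Equiv.prodCongr_apply, Prod.map_apply,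
    isComplement_equiv_mul]
  rfl

theorem exists_eq_mul_of_isComplement (hS : Subgroup.IsComplement S (H : Set A)) (a : A) :
    ∃ (s : S) (h : H), a = s * h :=
  ⟨(hS.equiv a).1, (hS.equiv a).2, (hS.equiv_fst_mul_equiv_snd a).symm⟩

/-- This equivariance is what the defining relations of HNN extensions and amalgams demand of the
action. -/
theorem torsorEquiv_mul (x : P × A) (h : H) :
    torsorEquiv hS hT ψ Θ (x.1, x.2 * h) =
      ((torsorEquiv hS hT ψ Θ x).1, (torsorEquiv hS hT ψ Θ x).2 * (ψ h : B)) := by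
  obtain ⟨p, a⟩ := x
  obtain ⟨s, k, rfl⟩ := exists_eq_mul_of_isComplement hS a
  have : ((s : A) * k * h) = s * ((k * h : H) : A) := by simp [mul_assoc]
  simp only [this, torsorEquiv_apply_mul]
  rw [map_mul, Subgroup.coe_mul, mul_assoc]

end Transversals

/-! ### Words as group elements. -/

section WordProd

variable {C G : Type*} [Group G]

/-- The product of the values of the letters of a word whose last letter comes first. -/
def wordProd (γ : C → G) : List C → G
  | [] => 1
  | c :: l => wordProd γ l * γ c

theorem wordProd_append (γ : C → G) (l l' : List C) :
    wordProd γ (l ++ l') = wordProd γ l' * wordProd γ l := by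
  induction l with
  | nil => simp [wordProd]
  | cons c l ih => simp [wordProd, ih, mul_assoc]

theorem finite_wordProd (γ : C → G) {E : Set C} (hE : E.Finite) (M : ℕ) :
    {g | ∃ l : List C, l.length ≤ M ∧ (∀ x ∈ l, x ∈ E) ∧ wordProd γ l = g}.Finite := by
  induction M with
  | zero =>
    refine (Set.finite_singleton 1).subset ?_
    rintro _ ⟨l, hl, -, rfl⟩
    rw [List.length_eq_zero_iff.1 (Nat.le_zero.1 hl)]
    rfl
  | succ M ih =>
    refine ((Set.finite_singleton 1).union (ih.mul (hE.image γ))).subset ?_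
    rintro _ ⟨_ | ⟨c, l⟩, hl, hx, rfl⟩
    · exact Or.inl rfl
    · refine Or.inr ⟨_, ⟨l, by simpa using hl, fun x hx' => hx x (by simp [hx']), rfl⟩, _,
        ⟨c, hx c (by simp), rfl⟩, rfl⟩

/-- A right action of `G` on `Ω` for which `ev` is equivariant, and for which `ev` provides
elements that carry a base point to any point, shows that `ev` is bijective. -/
theorem bijective_of_right_action {Ω : Type*} (ρ : G →* (Equiv.Perm Ω)ᵐᵒᵖ) (ω : Ω) (ev : Ω → G)
    (h1 : ev ω = 1) (hev : ∀ x g, ev ((ρ g).unop x) = ev x * g)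
    (hsurj : ∀ x, (ρ (ev x)).unop ω = x) : Function.Bijective ev := by
  refine ⟨fun x y h => ?_, fun g => ⟨(ρ g).unop ω, by rw [hev, h1, one_mul]⟩⟩
  rw [← hsurj x, ← hsurj y, h]

variable {D G' : Type*} [Group G']

/-- Here `pos c` marks the point of a coset from which the edge `c` leaves, and the image of a child
stays near the corresponding point. A bounded chain over `E` has finitely many values, as do the
corrections for redirected letters. For siblings over the same letter, both values are near `pos' (π
c)`, which cancels. -/
theorem exists_validWord_equiv_bounded (bk : C → C) (bk' : D → D) (hbk' : (Set.range bk').Finite)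
    (π : C → D) {N : ℕ} (hfin : ∀ d, (π ⁻¹' {d}).Finite)
    (hN : ∀ d, (π ⁻¹' {d}).ncard ≤ N) (htwo : ∀ d, ∃ c c', c ≠ c' ∧ π c = d ∧ π c' = d)
    {x y z : D} (hxy : x ≠ y) (hxz : x ≠ z) (hyz : y ≠ z)
    (γ : C → G) (γ' : D → G') (pos : C → G') (pos' : D → G)
    (h : (Set.range fun c => (pos c)⁻¹ * γ' (π c)).Finite)
    (h' : (Set.range fun c => (pos' (π c))⁻¹ * γ c).Finite) :
    ∃ φ : {l : List C // ValidWord bk l} ≃ {l : List D // ValidWord bk' l},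
      {g | ∃ c p, ∃ hc : ValidWord bk (c :: p),
        (pos c)⁻¹ * (wordProd γ' (φ ⟨p, hc.2⟩).1)⁻¹ * wordProd γ' (φ ⟨c :: p, hc⟩).1 = g}.Finite ∧
      {g | ∃ s q, ∃ hs : ValidWord bk' (s :: q), (pos' s)⁻¹ *
        (wordProd γ (φ.symm ⟨q, hs.2⟩).1)⁻¹ * wordProd γ (φ.symm ⟨s :: q, hs⟩).1 = g}.Finite := by
  obtain ⟨φ, E, M, hE, h1, h2⟩ :=
    exists_validWord_equiv bk bk' hbk' π hfin hN htwo hxy hxz hyz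
  set Q := Set.range fun c => (pos c)⁻¹ * γ' (π c) with hQ
  set Q' := Set.range fun c => (pos' (π c))⁻¹ * γ c with hQ'
  have hγE := hE.image γ'
  have hpE := hE.image pos'
  have hpp := hpE.inv.mul hpE
  refine ⟨φ, ?_, ?_⟩
  · refine (((h.union ((h.mul hγE.inv).mul hγE))).mul (finite_wordProd γ' hE M)).subset ?_
    rintro _ ⟨c, p, hc, rfl⟩
    obtain ⟨l, s, hlM, hlE, he, hs⟩ := h1 p c hc
    rw [he, wordProd_append, wordProd]
    refine ⟨(pos c)⁻¹ * γ' s, ?_, wordProd γ' l, ⟨l, hlM, hlE, rfl⟩, by simp only; group⟩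
    rcases hs with rfl | ⟨hs, hc'⟩
    · exact Or.inl ⟨c, rfl⟩
    · refine Or.inr ⟨_, ⟨_, ⟨c, rfl⟩, _, Set.inv_mem_inv.2 ⟨π c, hc', rfl⟩, rfl⟩, _, ⟨s, hs, rfl⟩, ?_⟩
      simp only; group
  · refine ((h'.union (hpp.mul h')).union
      (hpE.inv.mul ((h'.inv.mul h').union ((h'.inv.mul hpp).mul h')))).subset ?_
    rintro _ ⟨s, q, hs, rfl⟩
    rcases h2 q s hs with ⟨c, he, hsc⟩ | ⟨k, c, c', he, he', hsE, hcc⟩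
    · left
      rw [he, wordProd]
      rcases hsc with rfl | ⟨hsE, hc'⟩
      · exact Or.inl ⟨c, by simp only; group⟩
      · refine Or.inr ⟨_, ⟨_, Set.inv_mem_inv.2 ⟨s, hsE, rfl⟩, _, ⟨π c, hc', rfl⟩, rfl⟩, _,
          ⟨c, rfl⟩, ?_⟩
        simp only; group
    · right
      rw [he, he', wordProd, wordProd]
      refine ⟨_, Set.inv_mem_inv.2 ⟨s, hsE, rfl⟩, (γ c)⁻¹ * γ c', ?_, by simp only; group⟩
      rcases hcc with hcc | ⟨hc, hc'⟩
      · refine Or.inl ⟨_, Set.inv_mem_inv.2 ⟨c, rfl⟩, _, ⟨c', rfl⟩, ?_⟩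
        simp only [hcc]; group
      · refine Or.inr ⟨_, ⟨_, Set.inv_mem_inv.2 ⟨c, rfl⟩, _,
          ⟨_, Set.inv_mem_inv.2 ⟨π c, hc, rfl⟩, _, ⟨π c', hc', rfl⟩, rfl⟩, rfl⟩, _, ⟨c', rfl⟩, ?_⟩
        simp only; group

end WordProd

/-! ### Right multiplication as an action. -/

section RightAction

/-- The right action of `A` on `P × A`. -/
def rightMulHom (P A : Type*) [Group A] : A →* (Equiv.Perm (P × A))ᵐᵒᵖ where
  toFun a := MulOpposite.op ((Equiv.refl P).prodCongr (Equiv.mulRight a))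
  map_one' := by
    refine MulOpposite.unop_injective (Equiv.ext fun x => ?_)
    simp
  map_mul' a b := by
    refine MulOpposite.unop_injective (Equiv.ext fun x => ?_)
    exact Prod.ext rfl (mul_assoc _ _ _).symm

@[simp]
theorem rightMulHom_apply {P A : Type*} [Group A] (a : A) (x : P × A) :
    (rightMulHom P A a).unop x = (x.1, x.2 * a) := rfl

end RightAction

theorem fg_of_closure_range_union {A B G : Type*} [Group A] [Group B] [Group G] [Group.FG A]
    [Group.FG B] (f : A →* G) (g : B →* G)
    (h : Subgroup.closure (Set.range f ∪ Set.range g) = ⊤) : Group.FG G := by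
  obtain ⟨S, hS, hSf⟩ := Group.fg_iff.1 ‹Group.FG A›
  obtain ⟨T, hT, hTf⟩ := Group.fg_iff.1 ‹Group.FG B›
  refine Group.fg_iff.2 ⟨f '' S ∪ g '' T, ?_, (hSf.image f).union (hTf.image g)⟩
  rw [Subgroup.closure_union, ← MonoidHom.map_closure, ← MonoidHom.map_closure, hS, hT,
    ← MonoidHom.range_eq_map, ← MonoidHom.range_eq_map, ← h, Subgroup.closure_union,
    ← MonoidHom.coe_range, ← MonoidHom.coe_range, Subgroup.closure_eq, Subgroup.closure_eq]

/-! ### Normal forms and Lipschitz maps for HNN extensions. -/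

section HNN

open Subgroup MulOpposite

variable {A : Type*} [Group A] {F₁ F₂ : Subgroup A} (φ : F₁ ≃* F₂) {S T : Set A}
  (hS : IsComplement S (F₂ : Set A)) (hT : IsComplement T (F₁ : Set A)) (u₀ : S) (w₀ : T)

/-- Right multiplication by the stable letter, in terms of words. -/
noncomputable def hnnShift : Equiv.Perm ({l // ValidWord (backLetter u₀ w₀) l} × A) :=
  torsorEquiv hS hT φ.symm (crossEquiv u₀ w₀)

theorem hnnShift_apply_mul (p : {l // ValidWord (backLetter u₀ w₀) l}) (s : S) (f : F₂) :
    hnnShift φ hS hT u₀ w₀ (p, s * f) = ((crossEquiv u₀ w₀ (p, s)).1,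
      ((crossEquiv u₀ w₀ (p, s)).2 : A) * (φ.symm f : A)) :=
  torsorEquiv_apply_mul _ _ _ _ _ _ _

theorem hnnShift_apply (p : {l // ValidWord (backLetter u₀ w₀) l}) (s : S) :
    hnnShift φ hS hT u₀ w₀ (p, s) = ((crossEquiv u₀ w₀ (p, s)).1,
      ((crossEquiv u₀ w₀ (p, s)).2 : A)) := by
  simpa using hnnShift_apply_mul φ hS hT u₀ w₀ p s 1

/-- The right action of the HNN extension on pairs of a word and an element of the base group. -/
noncomputable def hnnAction :
    HNNExtension A F₁ F₂ φ →* (Equiv.Perm ({l // ValidWord (backLetter u₀ w₀) l} × A))ᵐᵒᵖ :=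
  HNNExtension.lift (rightMulHom _ A) (op (hnnShift φ hS hT u₀ w₀)) (by
    intro a
    refine unop_injective (Equiv.ext fun x => ?_)
    -- The relation `t * a = φ a * t`, read from left to right as a right action, is the
    -- equivariance of the shift.
    have h := torsorEquiv_mul hS hT φ.symm (crossEquiv u₀ w₀) x (φ a)
    rw [MulEquiv.symm_apply_apply] at h
    exact h.symm)

/-- The values of letters in the HNN extension. -/
def hnnLetter (φ : F₁ ≃* F₂) : S ⊕ T → HNNExtension A F₁ F₂ φ
  | .inl s => HNNExtension.of (s : A) * HNNExtension.t
  | .inr s => HNNExtension.of (s : A) * HNNExtension.t⁻¹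

/-- The element of the HNN extension given by a word and an element of the base group. -/
def hnnEval (x : {l // ValidWord (backLetter u₀ w₀) l} × A) : HNNExtension A F₁ F₂ φ :=
  wordProd (hnnLetter φ) x.1.1 * HNNExtension.of x.2

variable {u₀ w₀}

/-- Moving `f` past `t` turns it into `φ.symm f`. Then `s * t` is either a new letter or, for `s =
1`, cancels the `t⁻¹` of the last letter. -/
theorem hnnEval_shift (hu : (u₀ : A) = 1) (hw : (w₀ : A) = 1)
    (x : {l // ValidWord (backLetter u₀ w₀) l} × A) :
    hnnEval φ u₀ w₀ (hnnShift φ hS hT u₀ w₀ x) = hnnEval φ u₀ w₀ x * HNNExtension.t := by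
  obtain ⟨p, a⟩ := x
  obtain ⟨s, f, rfl⟩ := exists_eq_mul_of_isComplement hS a
  have key : (HNNExtension.of (f : A) : HNNExtension A F₁ F₂ φ) * HNNExtension.t =
    HNNExtension.t * HNNExtension.of (φ.symm f : A) := HNNExtension.of_mul_t f
  rw [hnnShift_apply_mul]
  rcases crossEquiv_cases u₀ w₀ p s with ⟨h, he⟩ | ⟨v, p', h, rfl, rfl, he⟩
  · rw [he]
    simp only [hnnEval, wordProd, hnnLetter, hw, one_mul, map_mul, mul_assoc, key]
  · rw [he]
    simp only [hnnEval, wordProd, hnnLetter, hu, one_mul, map_mul, mul_assoc, key,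
      inv_mul_cancel_left]

theorem hnnEval_action (hu : (u₀ : A) = 1) (hw : (w₀ : A) = 1)
    (g : HNNExtension A F₁ F₂ φ) (x : {l // ValidWord (backLetter u₀ w₀) l} × A) :
    hnnEval φ u₀ w₀ ((hnnAction φ hS hT u₀ w₀ g).unop x) = hnnEval φ u₀ w₀ x * g := by
  induction g using HNNExtension.induction_on generalizing x with
  | of a =>
    rw [hnnAction, HNNExtension.lift_of, rightMulHom_apply]
    simp [hnnEval, mul_assoc]
  | t =>
    rw [hnnAction, HNNExtension.lift_t]
    exact hnnEval_shift φ hS hT hu hw x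
  | mul g h hg hh =>
    rw [map_mul, unop_mul, Equiv.Perm.mul_apply, hh, hg, mul_assoc]
  | inv g hg =>
    have := hg ((hnnAction φ hS hT u₀ w₀ g⁻¹).unop x)
    rw [map_inv, unop_inv, ← Equiv.Perm.mul_apply, mul_inv_cancel, Equiv.Perm.one_apply] at this
    rw [map_inv, unop_inv, this, mul_inv_cancel_right]

/-- In a valid word each letter crosses an edge away from the root, so acting on the base point
rebuilds the word letter by letter. -/
theorem hnnAction_eval (hu : (u₀ : A) = 1) (hw : (w₀ : A) = 1)
    (x : {l // ValidWord (backLetter u₀ w₀) l} × A) :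
    (hnnAction φ hS hT u₀ w₀ (hnnEval φ u₀ w₀ x)).unop (⟨[], trivial⟩, 1) = x := by
  obtain ⟨⟨l, hl⟩, a⟩ := x
  have hof : ∀ (a : A) (y : {l // ValidWord (backLetter u₀ w₀) l} × A),
      (hnnAction φ hS hT u₀ w₀ (HNNExtension.of a)).unop y = (y.1, y.2 * a) := by
    intro a y
    rw [hnnAction, HNNExtension.lift_of, rightMulHom_apply]
  have ht : hnnAction φ hS hT u₀ w₀ HNNExtension.t = op (hnnShift φ hS hT u₀ w₀) := by
    rw [hnnAction, HNNExtension.lift_t]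
  suffices h : (hnnAction φ hS hT u₀ w₀ (wordProd (hnnLetter φ) l)).unop (⟨[], trivial⟩, 1) =
      (⟨l, hl⟩, 1) by
    rw [hnnEval, map_mul, unop_mul, Equiv.Perm.mul_apply, h, hof, one_mul]
  induction l with
  | nil => simp [wordProd]
  | cons c l ih =>
    rw [wordProd, map_mul, unop_mul, Equiv.Perm.mul_apply, ih hl.2]
    rcases c with s | s
    · rw [hnnLetter, map_mul, unop_mul, Equiv.Perm.mul_apply, hof, ht, unop_op, one_mul,
        hnnShift_apply, crossEquiv_of_validWord u₀ w₀ _ _ hl, hw]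
    · rw [hnnLetter, map_mul, unop_mul, Equiv.Perm.mul_apply, hof, map_inv, ht, unop_inv, unop_op,
        one_mul, Equiv.Perm.inv_eq_iff_eq]
      have h := crossEquiv_symm_of_validWord u₀ w₀ ⟨l, hl.2⟩ s hl
      rw [Equiv.symm_apply_eq] at h
      have h' := hnnShift_apply φ hS hT u₀ w₀ ⟨.inr s :: l, hl⟩ u₀
      rw [← h, hu] at h'
      exact h'.symm

/-- Every element of an HNN extension is uniquely a product of a valid word and an element of
the base group. -/
theorem hnnEval_bijective (hS : IsComplement S (F₂ : Set A)) (hT : IsComplement T (F₁ : Set A))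
    (hu : (u₀ : A) = 1) (hw : (w₀ : A) = 1) :
    Function.Bijective (hnnEval φ u₀ w₀) :=
  bijective_of_right_action (hnnAction φ hS hT u₀ w₀) (⟨[], trivial⟩, 1) _
    (by simp [hnnEval, wordProd]) (fun x g => hnnEval_action φ hS hT hu hw g x)
    (hnnAction_eval φ hS hT hu hw)

theorem hnn_closure : Subgroup.closure (Set.range (HNNExtension.of : A → HNNExtension A F₁ F₂ φ) ∪
    {HNNExtension.t}) = ⊤ := by
  refine eq_top_iff.2 fun g _ => ?_
  induction g using HNNExtension.induction_on with
  | of a => exact subset_closure (Or.inl ⟨a, rfl⟩)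
  | t => exact subset_closure (Or.inr rfl)
  | mul g h hg hh => exact mul_mem (hg trivial) (hh trivial)
  | inv g hg => exact inv_mem (hg trivial)

theorem hnn_fg [Group.FG A] : Group.FG (HNNExtension A F₁ F₂ φ) := by
  refine fg_of_closure_range_union HNNExtension.of (zpowersHom _ HNNExtension.t)
    (top_le_iff.1 ((hnn_closure φ).symm.le.trans (closure_mono ?_)))
  exact Set.union_subset_union_right _ (by
    rintro _ rfl
    exact ⟨Multiplicative.ofAdd 1, by simp⟩)

/-- A map on an HNN extension with finite associated subgroups is coarsely Lipschitz if it moves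
cosets of the base group by left translations, so that neighbours stay close. -/
theorem rightBounded_hnn (hS : IsComplement S (F₂ : Set A)) (hT : IsComplement T (F₁ : Set A))
    [Finite F₂] {G' : Type*} [Group G'] (k : A →* G')
    (Ψ : {l // ValidWord (backLetter u₀ w₀) l} → G') (hu : (u₀ : A) = 1) (hw : (w₀ : A) = 1)
    (hΨ : {g | ∃ c p, ∃ hc : ValidWord (backLetter u₀ w₀) (c :: p),
      (k (Sum.elim (Subtype.val) (Subtype.val) c))⁻¹ * (Ψ ⟨p, hc.2⟩)⁻¹ * Ψ ⟨c :: p, hc⟩ = g}.Finite)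
    (e : HNNExtension A F₁ F₂ φ → G') (he : ∀ x, e (hnnEval φ u₀ w₀ x) = Ψ x.1 * k x.2) :
    RightBounded e := by
  refine RightBounded.of_closure (hnn_closure φ) ?_
  have hof : ∀ g a, e (g * HNNExtension.of a) = e g * k a := by
    intro g a
    obtain ⟨x, rfl⟩ := (hnnEval_bijective φ hS hT hu hw).2 g
    have : hnnEval φ u₀ w₀ x * HNNExtension.of a = hnnEval φ u₀ w₀ (x.1, x.2 * a) := by
      simp [hnnEval, mul_assoc]
    rw [this, he, he]
    simp [mul_assoc]
  rintro _ (⟨a, rfl⟩ | rfl)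
  · refine (Set.finite_singleton (k a)).subset ?_
    rintro _ ⟨g, rfl⟩
    simp [hof]
  -- Multiplication by `t` crosses one edge, in one of its two directions; `f` and its transform
  -- contribute only finitely many factors.
  · have h2 : (Set.range fun f : F₂ => k f).Finite := Set.finite_range _
    have h1 : (Set.range fun f : F₂ => k (φ.symm f : A)).Finite := Set.finite_range _
    refine ((h2.inv.mul (hΨ.union hΨ.inv)).mul h1).subset ?_
    rintro _ ⟨g, rfl⟩
    obtain ⟨⟨p, a⟩, rfl⟩ := (hnnEval_bijective φ hS hT hu hw).2 g
    obtain ⟨s, f, rfl⟩ := exists_eq_mul_of_isComplement hS a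
    simp only
    rw [← hnnEval_shift φ hS hT hu hw, hnnShift_apply_mul, he, he]
    refine ⟨_, ⟨_, Set.inv_mem_inv.2 ⟨f, rfl⟩,
      (k s)⁻¹ * (Ψ p)⁻¹ * Ψ (crossEquiv u₀ w₀ (p, s)).1 * k (crossEquiv u₀ w₀ (p, s)).2, ?_, rfl⟩,
      _, ⟨f, rfl⟩, by simp only [map_mul]; group⟩
    rcases crossEquiv_cases u₀ w₀ p s with ⟨h, hc⟩ | ⟨v, p', h, rfl, rfl, hc⟩
    · rw [hc]
      exact Or.inl ⟨.inl s, p.1, h, by simp [hw]⟩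
    · rw [hc]
      refine Or.inr ⟨.inr v, p', h, ?_⟩
      simp [hu, mul_assoc]

end HNN

/-! ### Adding base points to a bijection. -/

section ExtendByPoint

variable {P X Y : Type*} {o : X} {o' : Y}

open Classical in
/-- Extend a bijection over additional base points. -/
noncomputable def extendByPoint (o : X) (o' : Y) (Θ : P × {x : X // x ≠ o} ≃ P × {y : Y // y ≠ o'}) :
    P × X ≃ P × Y where
  toFun x := if h : x.2 = o then (x.1, o') else ((Θ (x.1, ⟨x.2, h⟩)).1, (Θ (x.1, ⟨x.2, h⟩)).2)
  invFun y := if h : y.2 = o' then (y.1, o) else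
    ((Θ.symm (y.1, ⟨y.2, h⟩)).1, (Θ.symm (y.1, ⟨y.2, h⟩)).2)
  left_inv x := by
    by_cases h : x.2 = o
    · simp [h, Prod.ext_iff]
    · simp [h, (Θ (x.1, ⟨x.2, h⟩)).2.2]
  right_inv y := by
    by_cases h : y.2 = o'
    · simp [h, Prod.ext_iff]
    · simp [h, (Θ.symm (y.1, ⟨y.2, h⟩)).2.2]

variable (Θ : P × {x : X // x ≠ o} ≃ P × {y : Y // y ≠ o'})

theorem extendByPoint_base (p : P) : extendByPoint o o' Θ (p, o) = (p, o') := by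
  simp [extendByPoint]

theorem extendByPoint_of_ne (p : P) (x : {x : X // x ≠ o}) :
    extendByPoint o o' Θ (p, x) = ((Θ (p, x)).1, ((Θ (p, x)).2 : Y)) := by
  simp [extendByPoint, x.2]

end ExtendByPoint

/-! ### Normal forms and Lipschitz maps for amalgamated products. -/

section Amalgam

open Subgroup MulOpposite

variable {A B F : Type*} [Group A] [Group B] [Group F] (i : F →* A) (j : F →* B)

/-- The first factor of an amalgamated product. -/
def amalgInl : A →* AmalgamatedProduct i j := (QuotientGroup.mk' _).comp Monoid.Coprod.inl

/-- The second factor of an amalgamated product. -/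
def amalgInr : B →* AmalgamatedProduct i j := (QuotientGroup.mk' _).comp Monoid.Coprod.inr

theorem amalgInl_eq_amalgInr (f : F) : amalgInl i j (i f) = amalgInr i j (j f) := by
  rw [← mul_inv_eq_one, ← map_inv]
  exact (QuotientGroup.eq_one_iff _).2 (subset_normalClosure ⟨f, by simp⟩)

/-- Homomorphisms out of an amalgamated product. -/
def amalgLift {X : Type*} [Group X] (f : A →* X) (g : B →* X) (h : ∀ c, f (i c) = g (j c)) :
    AmalgamatedProduct i j →* X :=
  QuotientGroup.lift _ (Monoid.Coprod.lift f g) (normalClosure_le_normal (by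
    rintro _ ⟨c, rfl⟩
    simp [MonoidHom.mem_ker, h]))

variable {i j} in
theorem amalgLift_inl {X : Type*} [Group X] (f : A →* X) (g : B →* X) (h : ∀ c, f (i c) = g (j c))
    (a : A) : amalgLift i j f g h (amalgInl i j a) = f a := by
  simp [amalgLift, amalgInl]

variable {i j} in
theorem amalgLift_inr {X : Type*} [Group X] (f : A →* X) (g : B →* X) (h : ∀ c, f (i c) = g (j c))
    (b : B) : amalgLift i j f g h (amalgInr i j b) = g b := by
  simp [amalgLift, amalgInr]

theorem amalg_closure :
    closure (Set.range (amalgInl i j) ∪ Set.range (amalgInr i j)) = ⊤ := by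
  refine eq_top_iff.2 fun g _ => ?_
  obtain ⟨g, rfl⟩ := QuotientGroup.mk'_surjective _ g
  clear * -
  induction g using Monoid.Coprod.induction_on with
  | inl a => exact subset_closure (Or.inl ⟨a, rfl⟩)
  | inr b => exact subset_closure (Or.inr ⟨b, rfl⟩)
  | mul g h hg hh => rw [map_mul]; exact mul_mem hg hh

theorem amalg_fg [Group.FG A] [Group.FG B] : Group.FG (AmalgamatedProduct i j) :=
  fg_of_closure_range_union _ _ (amalg_closure i j)

variable {i j} (hi : Function.Injective i) (hj : Function.Injective j)

/-- The identification of the two images of the amalgamated subgroup. -/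
noncomputable def amalgIso : i.range ≃* j.range :=
  (MonoidHom.ofInjective hi).symm.trans (MonoidHom.ofInjective hj)

theorem amalgInl_coe (f : i.range) :
    amalgInl i j (f : A) = amalgInr i j (amalgIso hi hj f : B) := by
  obtain ⟨f, rfl⟩ := (MonoidHom.ofInjective hi).surjective f
  rw [amalgIso, MulEquiv.trans_apply, MulEquiv.symm_apply_apply]
  exact amalgInl_eq_amalgInr i j f

variable {S : Set A} {T : Set B} (hS : IsComplement S (i.range : Set A))
  (hT : IsComplement T (j.range : Set B)) (o : S) (o' : T) (u₀ : {s : S // s ≠ o})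
  (w₀ : {s : T // s ≠ o'})

/-- The comparison of the decompositions into cosets of `A` and into cosets of `B`. -/
noncomputable def amalgShift : {l // ValidWord (backLetter u₀ w₀) l} × A ≃
    {l // ValidWord (backLetter u₀ w₀) l} × B :=
  -- The edge with label `o` pairs the cosets of `A` and `B` at the same word; contracting these
  -- edges of the Bass–Serre tree leaves the tree of words.
  torsorEquiv hS hT (amalgIso hi hj) (extendByPoint o o' (crossEquiv u₀ w₀))

theorem amalgShift_base_mul (ho : (o : A) = 1) (ho' : (o' : B) = 1)
    (p : {l // ValidWord (backLetter u₀ w₀) l}) (f : i.range) :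
    amalgShift hi hj hS hT o o' u₀ w₀ (p, f) = (p, (amalgIso hi hj f : B)) := by
  have h := torsorEquiv_apply_mul hS hT (amalgIso hi hj)
    (extendByPoint o o' (crossEquiv u₀ w₀)) p o f
  rwa [extendByPoint_base, ho, ho', one_mul, one_mul] at h

theorem amalgShift_one (ho : (o : A) = 1) (ho' : (o' : B) = 1)
    (p : {l // ValidWord (backLetter u₀ w₀) l}) :
    amalgShift hi hj hS hT o o' u₀ w₀ (p, 1) = (p, 1) := by
  simpa using amalgShift_base_mul hi hj hS hT o o' u₀ w₀ ho ho' p 1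

theorem amalgShift_mul (p : {l // ValidWord (backLetter u₀ w₀) l}) (s : {s : S // s ≠ o})
    (f : i.range) :
    amalgShift hi hj hS hT o o' u₀ w₀ (p, s * f) = ((crossEquiv u₀ w₀ (p, s)).1,
      ((crossEquiv u₀ w₀ (p, s)).2 : B) * (amalgIso hi hj f : B)) := by
  have h := torsorEquiv_apply_mul hS hT (amalgIso hi hj)
    (extendByPoint o o' (crossEquiv u₀ w₀)) p s f
  rwa [extendByPoint_of_ne] at h

theorem amalgShift_apply (p : {l // ValidWord (backLetter u₀ w₀) l}) (s : {s : S // s ≠ o}) :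
    amalgShift hi hj hS hT o o' u₀ w₀ (p, s) = ((crossEquiv u₀ w₀ (p, s)).1,
      ((crossEquiv u₀ w₀ (p, s)).2 : B)) := by
  simpa using amalgShift_mul hi hj hS hT o o' u₀ w₀ p s 1

/-- The right action of the amalgamated product on pairs of a word and an element of `A`. -/
noncomputable def amalgAction : AmalgamatedProduct i j →*
    (Equiv.Perm ({l // ValidWord (backLetter u₀ w₀) l} × A))ᵐᵒᵖ :=
  amalgLift i j (rightMulHom _ A)
    ((MulEquiv.op (amalgShift hi hj hS hT o o' u₀ w₀).symm.permCongrHom).toMonoidHom.comp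
      (rightMulHom _ B)) (by
    intro c
    refine unop_injective (Equiv.ext fun x => ?_)
    have h := torsorEquiv_mul hS hT (amalgIso hi hj)
      (extendByPoint o o' (crossEquiv u₀ w₀)) x ⟨i c, c, rfl⟩
    have h' : amalgIso hi hj ⟨i c, c, rfl⟩ = ⟨j c, c, rfl⟩ := by
      have : (⟨i c, c, rfl⟩ : i.range) = MonoidHom.ofInjective hi c := rfl
      rw [this, amalgIso, MulEquiv.trans_apply, MulEquiv.symm_apply_apply]
      rfl
    rw [h'] at h
    exact (Equiv.eq_symm_apply (amalgShift hi hj hS hT o o' u₀ w₀)).2 h)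

theorem amalgAction_inl (a : A) (x : {l // ValidWord (backLetter u₀ w₀) l} × A) :
    (amalgAction hi hj hS hT o o' u₀ w₀ (amalgInl i j a)).unop x = (x.1, x.2 * a) := by
  rw [amalgAction, amalgLift_inl, rightMulHom_apply]

theorem amalgAction_inr (b : B) (x : {l // ValidWord (backLetter u₀ w₀) l} × A) :
    (amalgAction hi hj hS hT o o' u₀ w₀ (amalgInr i j b)).unop x =
      (amalgShift hi hj hS hT o o' u₀ w₀).symm ((amalgShift hi hj hS hT o o' u₀ w₀ x).1,
        (amalgShift hi hj hS hT o o' u₀ w₀ x).2 * b) := by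
  rw [amalgAction, amalgLift_inr]
  rfl

/-- The values of letters in the amalgamated product. -/
def amalgLetter : {s : S // s ≠ o} ⊕ {s : T // s ≠ o'} → AmalgamatedProduct i j
  | .inl s => amalgInl i j (s : A) * (amalgInr i j (w₀ : B))⁻¹
  | .inr s => amalgInr i j (s : B) * (amalgInl i j (u₀ : A))⁻¹

variable (i j) in
/-- The element of the amalgamated product given by a word and an element of `A`. -/
def amalgEval (x : {l // ValidWord (backLetter u₀ w₀) l} × A) : AmalgamatedProduct i j :=
  wordProd (amalgLetter o o' u₀ w₀) x.1.1 * amalgInl i j x.2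

variable (i j) in
/-- The element of the amalgamated product given by a word and an element of `B`. -/
def amalgEval' (x : {l // ValidWord (backLetter u₀ w₀) l} × B) : AmalgamatedProduct i j :=
  wordProd (amalgLetter o o' u₀ w₀) x.1.1 * amalgInr i j x.2

/-- The three ways in which a coset of `A` can meet a coset of `B`. -/
theorem amalgShift_cases (ho : (o : A) = 1) (ho' : (o' : B) = 1)
    (x : {l // ValidWord (backLetter u₀ w₀) l} × A) :
    ∃ f : i.range,
      (∃ p, x = (p, (f : A)) ∧
        amalgShift hi hj hS hT o o' u₀ w₀ x = (p, (amalgIso hi hj f : B))) ∨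
      (∃ (s : {s : S // s ≠ o}) (p : _) (h : ValidWord (backLetter u₀ w₀) (.inl s :: p)),
        x = (⟨p, h.2⟩, (s : A) * (f : A)) ∧ amalgShift hi hj hS hT o o' u₀ w₀ x =
          (⟨.inl s :: p, h⟩, (w₀ : B) * (amalgIso hi hj f : B))) ∨
      (∃ (v : {s : T // s ≠ o'}) (p : _) (h : ValidWord (backLetter u₀ w₀) (.inr v :: p)),
        x = (⟨.inr v :: p, h⟩, (u₀ : A) * (f : A)) ∧ amalgShift hi hj hS hT o o' u₀ w₀ x =
          (⟨p, h.2⟩, (v : B) * (amalgIso hi hj f : B))) := by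
  obtain ⟨p, a⟩ := x
  obtain ⟨s, f, rfl⟩ := exists_eq_mul_of_isComplement hS a
  refine ⟨f, ?_⟩
  by_cases hs : s = o
  · subst hs
    left
    refine ⟨p, by simp [ho], ?_⟩
    rw [ho, one_mul]
    exact amalgShift_base_mul hi hj hS hT _ o' u₀ w₀ ho ho' p f
  · right
    have h := amalgShift_mul hi hj hS hT o o' u₀ w₀ p ⟨s, hs⟩ f
    rcases crossEquiv_cases u₀ w₀ p ⟨s, hs⟩ with ⟨hv, he⟩ | ⟨v, p', hv, rfl, hu, he⟩
    · rw [he] at h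
      exact Or.inl ⟨⟨s, hs⟩, p.1, hv, rfl, h⟩
    · rw [he] at h
      subst hu
      exact Or.inr ⟨v, p', hv, rfl, h⟩

/-- The letters `s * w₀⁻¹` and `s * u₀⁻¹` are chosen so that a change of coordinates along an edge
does not change the element. Right multiplication by `B` can then be read in `B`-coordinates. -/
theorem amalgEval'_shift (ho : (o : A) = 1) (ho' : (o' : B) = 1)
    (x : {l // ValidWord (backLetter u₀ w₀) l} × A) :
    amalgEval' i j o o' u₀ w₀ (amalgShift hi hj hS hT o o' u₀ w₀ x) =
      amalgEval i j o o' u₀ w₀ x := by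
  obtain ⟨f, ⟨p, h, he⟩ | ⟨s, p, hv, h, he⟩ | ⟨v, p, hv, h, he⟩⟩ :=
    amalgShift_cases hi hj hS hT o o' u₀ w₀ ho ho' x
  · rw [he, h]
    simp only [amalgEval, amalgEval', amalgInl_coe hi hj]
  · rw [he, h]
    simp only [amalgEval, amalgEval', amalgInl_coe hi hj, wordProd, amalgLetter, map_mul]
    group
  · rw [he, h]
    simp only [amalgEval, amalgEval', amalgInl_coe hi hj, wordProd, amalgLetter, map_mul]
    group

theorem amalgEval_action (ho : (o : A) = 1) (ho' : (o' : B) = 1) (g : AmalgamatedProduct i j)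
    (x : {l // ValidWord (backLetter u₀ w₀) l} × A) :
    amalgEval i j o o' u₀ w₀ ((amalgAction hi hj hS hT o o' u₀ w₀ g).unop x) =
      amalgEval i j o o' u₀ w₀ x * g := by
  have hg : g ∈ closure (Set.range (amalgInl i j) ∪ Set.range (amalgInr i j)) := by
    rw [amalg_closure]; trivial
  induction hg using closure_induction generalizing x with
  | mem g hg =>
    rcases hg with ⟨a, rfl⟩ | ⟨b, rfl⟩
    · rw [amalgAction_inl]
      simp [amalgEval, mul_assoc]
    · rw [amalgAction_inr, ← amalgEval'_shift hi hj hS hT o o' u₀ w₀ ho ho',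
        Equiv.apply_symm_apply, ← amalgEval'_shift hi hj hS hT o o' u₀ w₀ ho ho']
      simp [amalgEval', mul_assoc]
  | one => simp
  | mul g h _ _ hg hh => rw [map_mul, unop_mul, Equiv.Perm.mul_apply, hh, hg, mul_assoc]
  | inv g _ hg =>
    have := hg ((amalgAction hi hj hS hT o o' u₀ w₀ g⁻¹).unop x)
    rw [map_inv, unop_inv, ← Equiv.Perm.mul_apply, mul_inv_cancel, Equiv.Perm.one_apply] at this
    rw [map_inv, unop_inv, this, mul_inv_cancel_right]

theorem amalgAction_eval (ho : (o : A) = 1) (ho' : (o' : B) = 1)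
    (x : {l // ValidWord (backLetter u₀ w₀) l} × A) :
    (amalgAction hi hj hS hT o o' u₀ w₀ (amalgEval i j o o' u₀ w₀ x)).unop (⟨[], trivial⟩, 1) =
      x := by
  obtain ⟨⟨l, hl⟩, a⟩ := x
  suffices h : (amalgAction hi hj hS hT o o' u₀ w₀
      (wordProd (amalgLetter o o' u₀ w₀) l)).unop (⟨[], trivial⟩, 1) = (⟨l, hl⟩, 1) by
    rw [amalgEval, map_mul, unop_mul, Equiv.Perm.mul_apply, h, amalgAction_inl, one_mul]
  induction l with
  | nil => simp [wordProd]
  | cons c l ih =>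
    have hone := amalgShift_one hi hj hS hT o o' u₀ w₀ ho ho'
    rw [wordProd, map_mul, unop_mul, Equiv.Perm.mul_apply, ih hl.2]
    rcases c with s | s
    · rw [amalgLetter, map_mul, unop_mul, Equiv.Perm.mul_apply, amalgAction_inl, ← map_inv,
        amalgAction_inr, one_mul, amalgShift_apply, crossEquiv_of_validWord u₀ w₀ _ _ hl,
        mul_inv_cancel, Equiv.symm_apply_eq, hone]
    · have h := crossEquiv_symm_of_validWord u₀ w₀ ⟨l, hl.2⟩ s hl
      rw [Equiv.symm_apply_eq] at h
      have h' := amalgShift_apply hi hj hS hT o o' u₀ w₀ ⟨.inr s :: l, hl⟩ u₀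
      rw [← h, eq_comm, ← Equiv.symm_apply_eq] at h'
      rw [amalgLetter, map_mul, unop_mul, Equiv.Perm.mul_apply, amalgAction_inr, hone, one_mul, h',
        ← map_inv, amalgAction_inl, mul_inv_cancel]

/-- Every element of an amalgamated product is uniquely a product of a valid word and an element
of `A`. -/
theorem amalgEval_bijective (hi : Function.Injective i) (hj : Function.Injective j)
    (hS : IsComplement S (i.range : Set A)) (hT : IsComplement T (j.range : Set B))
    (ho : (o : A) = 1) (ho' : (o' : B) = 1) :
    Function.Bijective (amalgEval i j o o' u₀ w₀) :=
  bijective_of_right_action (amalgAction hi hj hS hT o o' u₀ w₀) (⟨[], trivial⟩, 1) _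
    (by simp [amalgEval, wordProd])
    (fun x g => amalgEval_action hi hj hS hT o o' u₀ w₀ ho ho' g x)
    (amalgAction_eval hi hj hS hT o o' u₀ w₀ ho ho')

/-- A map on an amalgamated product over a finite group is coarsely Lipschitz if it moves
cosets of the factors by left translations, so that neighbours stay close. -/
theorem rightBounded_amalg [Finite F] (hi : Function.Injective i) (hj : Function.Injective j)
    (hS : IsComplement S (i.range : Set A)) (hT : IsComplement T (j.range : Set B))
    (ho : (o : A) = 1) (ho' : (o' : B) = 1) {G' : Type*} [Group G'] (k : A →* G') (k' : B →* G')
    (Ψ : {l // ValidWord (backLetter u₀ w₀) l} → G')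
    (hΨ : {g | ∃ c p, ∃ hc : ValidWord (backLetter u₀ w₀) (c :: p),
      (Sum.elim (fun s : {s : S // s ≠ o} => k (s : A))
        (fun s : {s : T // s ≠ o'} => k' (s : B)) c)⁻¹ * (Ψ ⟨p, hc.2⟩)⁻¹ *
        Ψ ⟨c :: p, hc⟩ = g}.Finite)
    (e : AmalgamatedProduct i j → G')
    (he : ∀ x, e (amalgEval i j o o' u₀ w₀ x) = Ψ x.1 * k x.2) : RightBounded e := by
  have hbij := amalgEval_bijective o o' u₀ w₀ hi hj hS hT ho ho'
  set σ := amalgShift hi hj hS hT o o' u₀ w₀ with hσ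
  -- Reading the image in `B`-coordinates instead of `A`-coordinates costs a bounded error.
  have hfin : (Set.range fun x => (Ψ x.1 * k x.2)⁻¹ * (Ψ (σ x).1 * k' (σ x).2)).Finite := by
    have : Finite i.range := (Set.finite_range i).to_subtype
    have h1 : (Set.range fun f : i.range => k f).Finite := Set.finite_range _
    have h2 : (Set.range fun f : i.range => k' (amalgIso hi hj f : B)).Finite := Set.finite_range _
    refine ((h1.inv.mul (((Set.finite_singleton 1).union
      (hΨ.mul (Set.finite_singleton (k' (w₀ : B))))).union
      ((Set.finite_singleton (k (u₀ : A))⁻¹).mul hΨ.inv))).mul h2).subset ?_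
    rintro _ ⟨x, rfl⟩
    obtain ⟨f, h⟩ := amalgShift_cases hi hj hS hT o o' u₀ w₀ ho ho' x
    suffices h' : k f * (Ψ x.1 * k x.2)⁻¹ * (Ψ (σ x).1 * k' (σ x).2) *
        (k' (amalgIso hi hj f : B))⁻¹ ∈ _ from
      ⟨_, ⟨_, Set.inv_mem_inv.2 ⟨f, rfl⟩, _, h', rfl⟩, _, ⟨f, rfl⟩, by simp only; group⟩
    rcases h with ⟨p, h, h'⟩ | ⟨s, p, hv, h, h'⟩ | ⟨v, p, hv, h, h'⟩
    · rw [h', h]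
      exact Or.inl (Or.inl (by simp))
    · rw [h', h]
      refine Or.inl (Or.inr ⟨_, ⟨.inl s, p, hv, rfl⟩, _, rfl, ?_⟩)
      simp only [Sum.elim_inl, map_mul]
      group
    · rw [h', h]
      refine Or.inr ⟨_, rfl, _, Set.inv_mem_inv.2 ⟨.inr v, p, hv, rfl⟩, ?_⟩
      simp only [Sum.elim_inr, map_mul]
      group
  refine RightBounded.of_closure (amalg_closure i j) ?_
  rintro _ (⟨a, rfl⟩ | ⟨b, rfl⟩)
  · refine (Set.finite_singleton (k a)).subset ?_
    rintro _ ⟨g, rfl⟩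
    obtain ⟨x, rfl⟩ := hbij.2 g
    have h : amalgEval i j o o' u₀ w₀ x * amalgInl i j a =
        amalgEval i j o o' u₀ w₀ (x.1, x.2 * a) := by
      simp [amalgEval, mul_assoc]
    simp only [h, he, Set.mem_singleton_iff, map_mul]
    group
  -- Pass to `B`-coordinates, multiply by `b` and return: two bounded errors around `k' b`.
  · refine ((hfin.mul (Set.finite_singleton (k' b))).mul hfin.inv).subset ?_
    rintro _ ⟨g, rfl⟩
    obtain ⟨x, rfl⟩ := hbij.2 g
    have h : amalgEval i j o o' u₀ w₀ x * amalgInr i j b =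
        amalgEval i j o o' u₀ w₀ (σ.symm ((σ x).1, (σ x).2 * b)) := by
      rw [← amalgEval'_shift hi hj hS hT o o' u₀ w₀ ho ho', ← hσ,
        ← amalgEval'_shift hi hj hS hT o o' u₀ w₀ ho ho', ← hσ, Equiv.apply_symm_apply]
      simp [amalgEval', mul_assoc]
    refine ⟨_, ⟨_, ⟨x, rfl⟩, _, rfl, rfl⟩, _,
      Set.inv_mem_inv.2 ⟨σ.symm ((σ x).1, (σ x).2 * b), rfl⟩, ?_⟩
    simp only [h, he, Equiv.apply_symm_apply, map_mul]
    group

end Amalgam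

/-! ### Fibres of the projections to transversals. -/

section Fibers

variable {X Y X' Y' : Type*}

/-- All fibres of `f` have at least two and at most `N` elements. -/
structure FewToOne (N : ℕ) (f : X → Y) : Prop where
  finite : ∀ y, (f ⁻¹' {y}).Finite
  ncard_le : ∀ y, (f ⁻¹' {y}).ncard ≤ N
  exists_ne : ∀ y, ∃ x x', x ≠ x' ∧ f x = y ∧ f x' = y

theorem FewToOne.sumMap {M N : ℕ} {f : X → Y} {g : X' → Y'} (hf : FewToOne M f)
    (hg : FewToOne N g) : FewToOne (max M N) (Sum.map f g) := by
  have h1 : ∀ y, Sum.map f g ⁻¹' {.inl y} = Sum.inl '' (f ⁻¹' {y}) := by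
    intro y
    ext (x | x) <;> simp
  have h2 : ∀ y, Sum.map f g ⁻¹' {.inr y} = Sum.inr '' (g ⁻¹' {y}) := by
    intro y
    ext (x | x) <;> simp
  constructor
  · rintro (y | y)
    · rw [h1]; exact (hf.finite y).image _
    · rw [h2]; exact (hg.finite y).image _
  · rintro (y | y)
    · rw [h1]
      exact (Set.ncard_image_le (hf.finite y)).trans ((hf.ncard_le y).trans (le_max_left _ _))
    · rw [h2]
      exact (Set.ncard_image_le (hg.finite y)).trans ((hg.ncard_le y).trans (le_max_right _ _))
  · rintro (y | y)
    · obtain ⟨x, x', hx, h, h'⟩ := hf.exists_ne y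
      exact ⟨.inl x, .inl x', by simpa using hx, by simp [h], by simp [h']⟩
    · obtain ⟨x, x', hx, h, h'⟩ := hg.exists_ne y
      exact ⟨.inr x, .inr x', by simpa using hx, by simp [h], by simp [h']⟩

/-- As `v` is injective, a point of the fibre over `y` is determined by its displacement in `Q`. -/
theorem fewToOne_of_mem {A : Type*} [Group A] {f : X → Y} {v : X → A} (hv : Function.Injective v)
    {v' : Y → A} {Q : Set A} (hQ : Q.Finite) (h : ∀ x, (v x)⁻¹ * v' (f x) ∈ Q)
    (h2 : ∀ y, ∃ x x', x ≠ x' ∧ f x = y ∧ f x' = y) : FewToOne Q.ncard f := by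
  have hmaps : ∀ y, Set.MapsTo (fun x => (v x)⁻¹ * v' y) (f ⁻¹' {y}) Q := by
    rintro _ x rfl
    exact h x
  have hinj : ∀ y, Set.InjOn (fun x => (v x)⁻¹ * v' y) (f ⁻¹' {y}) := by
    intro y x _ x' _ hx
    simpa using hv (by simpa using hx)
  exact ⟨fun y => hQ.of_injOn (hmaps y) (hinj y),
    fun y => Set.ncard_le_ncard_of_injOn _ (hmaps y) (hinj y) hQ, h2⟩

open Subgroup

variable {A : Type*} [Group A] {H : Subgroup A} {S : Set A}

/-- The projection of a group to a transversal. -/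
noncomputable def toTransversal (hS : IsComplement S (H : Set A)) (a : (Set.univ : Set A)) : S :=
  (hS.equiv a).1

theorem inv_mul_toTransversal (hS : IsComplement S (H : Set A)) (a : (Set.univ : Set A)) :
    (a : A)⁻¹ * toTransversal hS a ∈ H := by
  have h := hS.equiv_fst_mul_equiv_snd (a : A)
  have : (a : A)⁻¹ * toTransversal hS a = ((hS.equiv a).2 : A)⁻¹ := by
    rw [toTransversal, inv_mul_eq_iff_eq_mul, eq_mul_inv_iff_mul_eq]
    exact h
  rw [this]
  exact H.inv_mem (hS.equiv a).2.2

theorem toTransversal_mul (hS : IsComplement S (H : Set A)) (s : S) (h : H) :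
    toTransversal hS ⟨s * h, trivial⟩ = s := by
  rw [toTransversal, isComplement_equiv_mul]

/-- The fibres are the cosets `s * H`, which have at least two elements because `H` is nontrivial.
-/
theorem fewToOne_toTransversal [Finite H] [Nontrivial H] (hS : IsComplement S (H : Set A)) :
    FewToOne (H : Set A).ncard (toTransversal hS) := by
  refine fewToOne_of_mem Subtype.val_injective (Set.toFinite _) (inv_mul_toTransversal hS)
    fun s => ?_
  obtain ⟨h, h', hne⟩ := exists_pair_ne H
  refine ⟨_, _, fun he => hne ?_, toTransversal_mul hS s h, toTransversal_mul hS s h'⟩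
  exact Subtype.ext (mul_left_cancel (congrArg Subtype.val he))

open Classical in
/-- The projection of the nontrivial elements of a group to the nontrivial elements
of a transversal, where the elements of the subgroup go to a given element. -/
noncomputable def toTransversalNe (hS : IsComplement S (H : Set A)) {o : S}
    (u₀ : {s : S // s ≠ o}) {o₁ : (Set.univ : Set A)} (a : {s : (Set.univ : Set A) // s ≠ o₁}) :
    {s : S // s ≠ o} :=
  if h : toTransversal hS a = o then u₀ else ⟨toTransversal hS a, h⟩

theorem exists_finite_toTransversalNe [Finite H] (hS : IsComplement S (H : Set A)) {o : S}
    (ho : (o : A) = 1) (u₀ : {s : S // s ≠ o}) (o₁ : (Set.univ : Set A)) :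
    ∃ Q : Set A, Q.Finite ∧ ∀ a : {s : (Set.univ : Set A) // s ≠ o₁},
      ((a : (Set.univ : Set A)) : A)⁻¹ * (toTransversalNe hS u₀ a : S) ∈ Q := by
  have hH : (H : Set A).Finite := Set.toFinite _
  refine ⟨H ∪ (· * (u₀ : A)) '' H, hH.union (hH.image _), fun a => ?_⟩
  have h := inv_mul_toTransversal hS a
  by_cases ha : toTransversal hS a = o
  · right
    rw [ha, ho, mul_one] at h
    simp only [toTransversalNe, dif_pos ha]
    exact ⟨_, h, rfl⟩
  · left
    simp only [toTransversalNe, dif_neg ha]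
    exact h

/-- The coset of `s ≠ o` avoids the identity, so it lies in the fibre as a whole; only the fibre of
`u₀` also receives elements of `H`. -/
theorem exists_fewToOne_toTransversalNe [Finite H] [Nontrivial H]
    (hS : IsComplement S (H : Set A)) {o : S} (ho : (o : A) = 1) (u₀ : {s : S // s ≠ o})
    {o₁ : (Set.univ : Set A)} (ho₁ : (o₁ : A) = 1) :
    ∃ N, FewToOne N (toTransversalNe hS u₀ : {s : (Set.univ : Set A) // s ≠ o₁} → _) := by
  obtain ⟨Q, hQ, h⟩ := exists_finite_toTransversalNe hS ho u₀ o₁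
  refine ⟨_, fewToOne_of_mem
    (v := fun a : {s : (Set.univ : Set A) // s ≠ o₁} => ((a : (Set.univ : Set A)) : A))
    (Subtype.val_injective.comp Subtype.val_injective) (v' := fun s : {s : S // s ≠ o} => ((s : S) : A))
    hQ h fun s => ?_⟩
  have key : ∀ h : H, ∃ a : {s : (Set.univ : Set A) // s ≠ o₁},
      ((a : (Set.univ : Set A)) : A) = s * h ∧ toTransversalNe hS u₀ a = s := by
    intro h
    have ht := toTransversal_mul hS s h
    refine ⟨⟨⟨s * h, trivial⟩, fun h' => s.2 ?_⟩, rfl, ?_⟩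
    · have h1 : (s * h : A) = o * (1 : H) := by
        simpa [ho, ho₁] using congrArg Subtype.val h'
      have h2 := toTransversal_mul hS o 1
      simp only [← h1] at h2
      exact ht.symm.trans h2
    · have hne : ¬ toTransversal hS ⟨(s : A) * h, trivial⟩ = o := by rw [ht]; exact s.2
      simp only [toTransversalNe, dif_neg hne]
      exact Subtype.ext ht
  obtain ⟨f, f', hne⟩ := exists_pair_ne H
  obtain ⟨a, ha, ha'⟩ := key f
  obtain ⟨b, hb, hb'⟩ := key f'
  refine ⟨a, b, fun hab => hne ?_, ha', hb'⟩
  rw [← hab, ha] at hb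
  simpa using hb

theorem isComplement_univ_of_eq_bot (h : H = ⊥) : IsComplement (Set.univ : Set A) (H : Set A) := by
  subst h
  rw [coe_bot]
  exact isComplement_univ_singleton

end Fibers

/-! ### Trivial edge groups give free products. -/

section FreeProducts

open Subgroup

theorem amalg_hom_ext {A B F X : Type*} [Group A] [Group B] [Group F] [Group X] {i : F →* A}
    {j : F →* B} {f g : AmalgamatedProduct i j →* X} (h : ∀ a, f (amalgInl i j a) = g (amalgInl i j a))
    (h' : ∀ b, f (amalgInr i j b) = g (amalgInr i j b)) : f = g :=
  QuotientGroup.monoidHom_ext _ (Monoid.Coprod.hom_ext (MonoidHom.ext h) (MonoidHom.ext h'))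

/-- An amalgamated product over a trivial group is a free product. -/
def amalgMulEquivCoprod {A B F : Type*} [Group A] [Group B] [Group F] [Subsingleton F]
    (i : F →* A) (j : F →* B) : AmalgamatedProduct i j ≃* Monoid.Coprod A B :=
  MonoidHom.toMulEquiv
    (amalgLift i j Monoid.Coprod.inl Monoid.Coprod.inr fun c => by
      rw [Subsingleton.elim c 1]; simp)
    (Monoid.Coprod.lift (amalgInl i j) (amalgInr i j))
    (amalg_hom_ext
      (fun a => by simp [amalgLift_inl])
      (fun b => by simp [amalgLift_inr]))
    (Monoid.Coprod.hom_ext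
      (MonoidHom.ext fun a => by simp [amalgLift_inl])
      (MonoidHom.ext fun b => by simp [amalgLift_inr]))

/-- An HNN extension over a trivial group is a free product with an infinite cyclic group. -/
def hnnMulEquivCoprod {A : Type*} [Group A] {F₁ F₂ : Subgroup A} (φ : F₁ ≃* F₂) [Subsingleton F₁] :
    HNNExtension A F₁ F₂ φ ≃* Monoid.Coprod A (Multiplicative ℤ) :=
  MonoidHom.toMulEquiv
    (HNNExtension.lift Monoid.Coprod.inl (Monoid.Coprod.inr (Multiplicative.ofAdd 1)) fun c => by
      rw [Subsingleton.elim c 1]; simp)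
    (Monoid.Coprod.lift HNNExtension.of (zpowersHom _ HNNExtension.t))
    (HNNExtension.hom_ext (MonoidHom.ext fun a => by simp) (by simp))
    (Monoid.Coprod.hom_ext (MonoidHom.ext fun a => by simp) (MonoidHom.ext_mint (by simp)))

theorem coprod_fg {A B : Type*} [Group A] [Group B] [Group.FG A] [Group.FG B] :
    Group.FG (Monoid.Coprod A B) := by
  have := amalg_fg (1 : PUnit.{1} →* A) (1 : PUnit.{1} →* B)
  exact Group.fg_of_surjective (f := (amalgMulEquivCoprod _ _).toMonoidHom)
    (amalgMulEquivCoprod (1 : PUnit.{1} →* A) (1 : PUnit.{1} →* B)).surjective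

end FreeProducts

/-! ### Comparing trivial and nontrivial edge groups. -/

section Comparison

open Subgroup

/-- In normal form both groups are words times `A`: match the words and keep the element of `A`. -/
theorem exists_hnn_equiv {A : Type*} [Group A] {F₁ F₂ : Subgroup A} (φ : F₁ ≃* F₂) [Finite F₁]
    [Nontrivial F₁] (hF : F₁ ≠ ⊤) :
    ∃ e : HNNExtension A ⊥ ⊥ (MulEquiv.refl _) ≃ HNNExtension A F₁ F₂ φ,
      RightBounded e ∧ RightBounded e.symm := by
  have : Finite F₂ := Finite.of_equiv _ φ.toEquiv
  have : Nontrivial F₂ := φ.symm.toEquiv.nontrivial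
  obtain ⟨S, hS, hS1⟩ := F₂.exists_isComplement_left 1
  obtain ⟨T, hT, hT1⟩ := F₁.exists_isComplement_left 1
  let u₀ : S := ⟨1, hS1⟩
  let w₀ : T := ⟨1, hT1⟩
  -- The third letter besides `u₀` and `w₀` exists because the subgroup is proper.
  obtain ⟨t, ht⟩ : ∃ t : T, t ≠ w₀ := by
    by_contra! h
    refine hF (eq_top_iff.2 fun a _ => ?_)
    obtain ⟨t, f, rfl⟩ := exists_eq_mul_of_isComplement hT a
    rw [h t]
    simp [w₀]
  let o : (Set.univ : Set A) := ⟨1, trivial⟩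
  have hU : IsComplement (Set.univ : Set A) ((⊥ : Subgroup A) : Set A) :=
    isComplement_univ_of_eq_bot rfl
  have hπ := (fewToOne_toTransversal hS).sumMap (fewToOne_toTransversal hT)
  let k₁ : A →* HNNExtension A ⊥ ⊥ (MulEquiv.refl _) := HNNExtension.of
  let k₂ : A →* HNNExtension A F₁ F₂ φ := HNNExtension.of
  obtain ⟨θ, h1, h2⟩ := exists_validWord_equiv_bounded (backLetter o o) (backLetter u₀ w₀)
    (finite_range_backLetter u₀ w₀) (Sum.map (toTransversal hS) (toTransversal hT))
    hπ.finite hπ.ncard_le hπ.exists_ne (x := .inl u₀) (y := .inr w₀) (z := .inr t)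
    (by simp) (by simp) (by simpa using ht.symm)
    (hnnLetter (MulEquiv.refl _)) (hnnLetter φ)
    (fun c => k₂ (Sum.elim Subtype.val Subtype.val c))
    (fun c => k₁ (Sum.elim Subtype.val Subtype.val c))
    (by
      refine ((((Set.toFinite (F₂ : Set A)).image k₂).mul
        (Set.finite_singleton HNNExtension.t)).union
        (((Set.toFinite (F₁ : Set A)).image k₂).mul
          (Set.finite_singleton HNNExtension.t⁻¹))).subset ?_
      rintro _ ⟨a | a, rfl⟩
      · refine Or.inl ⟨_, ⟨_, inv_mul_toTransversal hS a, rfl⟩, _, rfl, ?_⟩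
        simp [hnnLetter, k₂, mul_assoc]
      · refine Or.inr ⟨_, ⟨_, inv_mul_toTransversal hT a, rfl⟩, _, rfl, ?_⟩
        simp [hnnLetter, k₂, mul_assoc])
    (by
      refine ((((Set.toFinite (F₂ : Set A)).image k₁).inv.mul
        (Set.finite_singleton HNNExtension.t)).union
        (((Set.toFinite (F₁ : Set A)).image k₁).inv.mul
          (Set.finite_singleton HNNExtension.t⁻¹))).subset ?_
      rintro _ ⟨a | a, rfl⟩
      · refine Or.inl ⟨_, Set.inv_mem_inv.2 ⟨_, inv_mul_toTransversal hS a, rfl⟩, _, rfl, ?_⟩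
        simp [hnnLetter, k₁, mul_assoc]
      · refine Or.inr ⟨_, Set.inv_mem_inv.2 ⟨_, inv_mul_toTransversal hT a, rfl⟩, _, rfl, ?_⟩
        simp [hnnLetter, k₁, mul_assoc])
  let κ₁ := Equiv.ofBijective _ (hnnEval_bijective (MulEquiv.refl _) hU hU (u₀ := o) (w₀ := o)
    rfl rfl)
  let κ₂ := Equiv.ofBijective _ (hnnEval_bijective φ hS hT (u₀ := u₀) (w₀ := w₀) rfl rfl)
  refine ⟨κ₁.symm.trans ((θ.prodCongr (Equiv.refl A)).trans κ₂), ?_, ?_⟩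
  · refine rightBounded_hnn (MulEquiv.refl _) hU hU k₂ (fun p => wordProd (hnnLetter φ) (θ p).1)
      rfl rfl h1 _ fun x => ?_
    have : κ₁.symm (hnnEval (MulEquiv.refl _) o o x) = x := κ₁.symm_apply_apply x
    rw [Equiv.trans_apply, this]
    rfl
  · refine rightBounded_hnn φ hS hT k₁
      (fun p => wordProd (hnnLetter (MulEquiv.refl _)) (θ.symm p).1) rfl rfl h2 _ fun x => ?_
    have : κ₂.symm (hnnEval φ u₀ w₀ x) = x := κ₂.symm_apply_apply x
    change κ₁ ((θ.prodCongr (Equiv.refl A)).symm (κ₂.symm (hnnEval φ u₀ w₀ x))) = _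
    rw [this]
    rfl

theorem exists_ne_of_range_ne_top {A F : Type*} [Group A] [Group F] {i : F →* A}
    (h : i.range ≠ ⊤) {S : Set A} (hS : IsComplement S (i.range : Set A)) {o : S}
    (ho : (o : A) = 1) : ∃ s : S, s ≠ o := by
  by_contra! h'
  refine h (eq_top_iff.2 fun a _ => ?_)
  obtain ⟨t, f, rfl⟩ := exists_eq_mul_of_isComplement hS a
  rw [h' t, ho, one_mul]
  exact f.2

theorem index_eq_two_of_forall {A : Type*} [Group A] {H : Subgroup A} {S : Set A}
    (hS : IsComplement S (H : Set A)) {o : S} {u : {s : S // s ≠ o}}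
    (h : ∀ s : {s : S // s ≠ o}, s = u) : H.index = 2 := by
  rw [← hS.card_left]
  refine Nat.card_eq_two_iff.2 ⟨o, u, u.2.symm, Set.eq_univ_of_forall fun s => ?_⟩
  by_cases hs : s = o
  · exact Or.inl hs
  · exact Or.inr (congrArg Subtype.val (h ⟨s, hs⟩))

theorem exists_amalg_equiv {A B F : Type*} [Group A] [Group B] [Group F] [Finite F] [Nontrivial F]
    (i : F →* A) (j : F →* B) (hi : Function.Injective i) (hj : Function.Injective j)
    (hi' : i.range ≠ ⊤) (hj' : j.range ≠ ⊤) (hij : ¬ (i.range.index = 2 ∧ j.range.index = 2)) :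
    ∃ e : AmalgamatedProduct (1 : PUnit.{1} →* A) (1 : PUnit.{1} →* B) ≃ AmalgamatedProduct i j,
      RightBounded e ∧ RightBounded e.symm := by
  have : Finite i.range := (Set.finite_range i).to_subtype
  have : Finite j.range := (Set.finite_range j).to_subtype
  have : Nontrivial i.range := (MonoidHom.ofInjective hi).symm.toEquiv.nontrivial
  have : Nontrivial j.range := (MonoidHom.ofInjective hj).symm.toEquiv.nontrivial
  obtain ⟨S, hS, hS1⟩ := i.range.exists_isComplement_left 1
  obtain ⟨T, hT, hT1⟩ := j.range.exists_isComplement_left 1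
  let o : S := ⟨1, hS1⟩
  let o' : T := ⟨1, hT1⟩
  obtain ⟨u, hu⟩ := exists_ne_of_range_ne_top hi' hS (o := o) rfl
  obtain ⟨w, hw⟩ := exists_ne_of_range_ne_top hj' hT (o := o') rfl
  let u₀ : {s : S // s ≠ o} := ⟨u, hu⟩
  let w₀ : {s : T // s ≠ o'} := ⟨w, hw⟩
  -- Without a third letter the transversals would be `{o, u₀}` and `{o', w₀}`, and both indices
  -- would be `2`.
  obtain ⟨z, hz, hz'⟩ : ∃ z : {s : S // s ≠ o} ⊕ {s : T // s ≠ o'}, .inl u₀ ≠ z ∧ .inr w₀ ≠ z := by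
    by_contra! h
    refine hij ⟨index_eq_two_of_forall hS (u := u₀) fun s => ?_,
      index_eq_two_of_forall hT (u := w₀) fun s => ?_⟩
    · by_contra hs
      simpa using h (.inl s) (by simpa using Ne.symm hs)
    · simpa using (h (.inr s) (by simp)).symm
  let p : (Set.univ : Set A) := ⟨1, trivial⟩
  let p' : (Set.univ : Set B) := ⟨1, trivial⟩
  let u₁ : {s : (Set.univ : Set A) // s ≠ p} :=
    ⟨⟨u, trivial⟩, fun h => hu (Subtype.ext (congrArg (fun x : (Set.univ : Set A) => (x : A)) h))⟩
  let w₁ : {s : (Set.univ : Set B) // s ≠ p'} :=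
    ⟨⟨w, trivial⟩, fun h => hw (Subtype.ext (congrArg (fun x : (Set.univ : Set B) => (x : B)) h))⟩
  have hU : IsComplement (Set.univ : Set A) ((1 : PUnit.{1} →* A).range : Set A) :=
    isComplement_univ_of_eq_bot MonoidHom.range_one
  have hU' : IsComplement (Set.univ : Set B) ((1 : PUnit.{1} →* B).range : Set B) :=
    isComplement_univ_of_eq_bot MonoidHom.range_one
  obtain ⟨M, hM⟩ := exists_fewToOne_toTransversalNe hS (o := o) rfl u₀ (o₁ := p) rfl
  obtain ⟨N, hN⟩ := exists_fewToOne_toTransversalNe hT (o := o') rfl w₀ (o₁ := p') rfl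
  have hπ := hM.sumMap hN
  obtain ⟨Q, hQf, hQ⟩ := exists_finite_toTransversalNe hS (o := o) rfl u₀ p
  obtain ⟨R, hRf, hR⟩ := exists_finite_toTransversalNe hT (o := o') rfl w₀ p'
  let k₁ := amalgInl (1 : PUnit.{1} →* A) (1 : PUnit.{1} →* B)
  let l₁ := amalgInr (1 : PUnit.{1} →* A) (1 : PUnit.{1} →* B)
  let k₂ := amalgInl i j
  let l₂ := amalgInr i j
  let γ₁ := amalgLetter (i := (1 : PUnit.{1} →* A)) (j := (1 : PUnit.{1} →* B)) p p' u₁ w₁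
  let γ₂ := amalgLetter (i := i) (j := j) o o' u₀ w₀
  obtain ⟨θ, h1, h2⟩ := exists_validWord_equiv_bounded (backLetter u₁ w₁) (backLetter u₀ w₀)
    (finite_range_backLetter u₀ w₀) (Sum.map (toTransversalNe hS u₀) (toTransversalNe hT w₀))
    hπ.finite hπ.ncard_le hπ.exists_ne (x := .inl u₀) (y := .inr w₀) (z := z)
    (by simp) hz hz' γ₁ γ₂
    (Sum.elim (fun s => k₂ ((s : (Set.univ : Set A)) : A))
      (fun s => l₂ ((s : (Set.univ : Set B)) : B)))
    (Sum.elim (fun s => k₁ ((s : S) : A)) (fun s => l₁ ((s : T) : B)))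
    (by
      refine (((hQf.image k₂).mul (Set.finite_singleton (l₂ (w₀ : B))⁻¹)).union
        ((hRf.image l₂).mul (Set.finite_singleton (k₂ (u₀ : A))⁻¹))).subset ?_
      rintro _ ⟨a | a, rfl⟩
      · refine Or.inl ⟨_, ⟨_, hQ a, rfl⟩, _, rfl, ?_⟩
        simp [γ₂, amalgLetter, k₂, l₂, mul_assoc]
      · refine Or.inr ⟨_, ⟨_, hR a, rfl⟩, _, rfl, ?_⟩
        simp [γ₂, amalgLetter, k₂, l₂, mul_assoc])
    (by
      refine (((hQf.image k₁).inv.mul (Set.finite_singleton (l₁ (w₁ : B))⁻¹)).union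
        ((hRf.image l₁).inv.mul (Set.finite_singleton (k₁ (u₁ : A))⁻¹))).subset ?_
      rintro _ ⟨a | a, rfl⟩
      · refine Or.inl ⟨_, Set.inv_mem_inv.2 ⟨_, hQ a, rfl⟩, _, rfl, ?_⟩
        simp [γ₁, amalgLetter, k₁, l₁, mul_assoc]
      · refine Or.inr ⟨_, Set.inv_mem_inv.2 ⟨_, hR a, rfl⟩, _, rfl, ?_⟩
        simp [γ₁, amalgLetter, k₁, l₁, mul_assoc])
  have hinj : Function.Injective (1 : PUnit.{1} →* A) := Function.injective_of_subsingleton _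
  have hinj' : Function.Injective (1 : PUnit.{1} →* B) := Function.injective_of_subsingleton _
  let κ₁ := Equiv.ofBijective _ (amalgEval_bijective p p' u₁ w₁ hinj hinj' hU hU' rfl rfl)
  let κ₂ := Equiv.ofBijective _ (amalgEval_bijective o o' u₀ w₀ hi hj hS hT rfl rfl)
  refine ⟨κ₁.symm.trans ((θ.prodCongr (Equiv.refl A)).trans κ₂), ?_, ?_⟩
  · refine rightBounded_amalg p p' u₁ w₁ hinj hinj' hU hU' rfl rfl k₂ l₂
      (fun x => wordProd γ₂ (θ x).1) h1 _ fun x => ?_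
    have : κ₁.symm (amalgEval _ _ p p' u₁ w₁ x) = x := κ₁.symm_apply_apply x
    rw [Equiv.trans_apply, this]
    rfl
  · refine rightBounded_amalg o o' u₀ w₀ hi hj hS hT rfl rfl k₁ l₁
      (fun x => wordProd γ₁ (θ.symm x).1) h2 _ fun x => ?_
    have : κ₂.symm (amalgEval i j o o' u₀ w₀ x) = x := κ₂.symm_apply_apply x
    change κ₁ ((θ.prodCongr (Equiv.refl A)).symm (κ₂.symm (amalgEval i j o o' u₀ w₀ x))) = _
    rw [this]
    rfl

end Comparison

theorem groupQuasiIsometric_of_equiv_of_mulEquiv {G H K : Type*} [Group G] [Group H] [Group K]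
    [Group.FG G] [Group.FG K] (e : H ≃ G) (he : RightBounded e) (he' : RightBounded e.symm)
    (m : H ≃* K) : GroupQuasiIsometric G K :=
  groupQuasiIsometric_of_rightBounded (e.symm.trans m.toEquiv)
    ((MonoidHom.rightBounded m.toMonoidHom).comp he')
    (he.comp (MonoidHom.rightBounded m.symm.toMonoidHom))

theorem theorem2 :
    (∀ (A : Type*) (B : Type*) (F : Type*) [Group A] [Group B] [Group F]
      [Group.FG A] [Group.FG B] [Finite F]
      (i : F →* A) (j : F →* B),
      Function.Injective i → Function.Injective j →
      i.range ≠ ⊤ → j.range ≠ ⊤ →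
      ¬ (i.range.index = 2 ∧ j.range.index = 2) →
      GroupQuasiIsometric (AmalgamatedProduct i j) (Monoid.Coprod A B)) ∧
    (∀ (A : Type*) [Group A] [Group.FG A] (F₁ F₂ : Subgroup A) (φ : F₁ ≃* F₂),
      Finite F₁ → F₁ ≠ ⊤ →
      GroupQuasiIsometric (HNNExtension A F₁ F₂ φ)
        (Monoid.Coprod A (Multiplicative ℤ))) := by
  refine ⟨?_, ?_⟩
  · intro A B F _ _ _ _ _ _ i j hi hj hi' hj' hij
    have := amalg_fg i j
    have := coprod_fg (A := A) (B := B)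
    -- For trivial `F` the projection is not two-to-one, but the groups are already isomorphic.
    rcases subsingleton_or_nontrivial F with hF | hF
    · exact groupQuasiIsometric_of_equiv_of_mulEquiv (Equiv.refl _)
        (MonoidHom.rightBounded (MonoidHom.id _)) (MonoidHom.rightBounded (MonoidHom.id _))
        (amalgMulEquivCoprod i j)
    · obtain ⟨e, he, he'⟩ := exists_amalg_equiv i j hi hj hi' hj' hij
      exact groupQuasiIsometric_of_equiv_of_mulEquiv e he he' (amalgMulEquivCoprod 1 1)
  · intro A _ _ F₁ F₂ φ hfin hF₁
    have := hnn_fg φ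
    have := coprod_fg (A := A) (B := Multiplicative ℤ)
    rcases subsingleton_or_nontrivial F₁ with hF | hF
    · exact groupQuasiIsometric_of_equiv_of_mulEquiv (Equiv.refl _)
        (MonoidHom.rightBounded (MonoidHom.id _)) (MonoidHom.rightBounded (MonoidHom.id _))
        (hnnMulEquivCoprod φ)
    · obtain ⟨e, he, he'⟩ := exists_hnn_equiv φ hF₁
      exact groupQuasiIsometric_of_equiv_of_mulEquiv e he he' (hnnMulEquivCoprod _)
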